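/- Fix $d\in\mathbb N$, $2<p<\infty$, a constant $c>0$ and summable sequences $(\iota(l))_{l\ge0}$, $(\varepsilon(l))_{l\ge0}$ of non-negative reals. There is a finite constant $C$, depending only on $d,p,c,\iota,\varepsilon$, such that the following holds. For $k\ge 0$ and $1\le i\le d$ let $a_i(k)$ be non-negative integers with $a_i(0)=0$, $a_i(k)\le a_i(k+1)$, and, for each $k$, $a_i(k)<a_i(k+1)$ for at least one $i$. Put $H_k=\prod_{i=1}^d[-2^{a_i(k)},2^{a_i(k)})\subset\mathbb Z^d$, and let $\mathbb E_kf(x)$ be the average of $f$ over the dyadic rectangle $\prod_{i=1}^d 2^{a_i(k)}[m_i,m_i+1)$ ($m_i\in\mathbb Z$) that contains $x$. For finite $E,H\subset\mathbb Z^d$ put $B(E,H)=|\{x\in\mathbb Z^d:\partial E\cap(H-x)\neq\emptyset\}|$, where $\partial E$ is the set of points of $E$ with a nearest neighbour in $\mathbb Z^d\setminus E$. Let $\mathcal A=\{\mathcal A_k\}_{k\ge0}$ be collections of finite subsets of $\mathbb Z^d$ such that, for all $k,l\ge0$: 1. (location) $E\subset H_k$ for every $E\in\mathcal A_k$; 2.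 (size) $c|H_k|\le|E|$ for every $E\in\mathcal A_k$; 3. (smoothness) $B(E,H_k)/|H_{k+l}|\le\iota(l)^2$ for every $E\in\mathcal A_{k+l}$; 4. (eccentricity) $B(H_{k+l},H_k)/|H_{k+l}|\le\varepsilon(l)^2$. Let $\{E_t\}_{t\ge1}$ ($t$ an integer) be finite subsets of $\mathbb Z^d$ such that $E_t\subset E_{t'}$ and $E_t,E_{t'}\in\mathcal A_k$ whenever $2^k\le t\le t'<2^{k+1}$, and put $A_tf(x)=|E_t|^{-1}\sum_{y\in E_t}f(x-y)$. Then the long and short square functions $$\mathcal S^L_{\mathcal A}f=\Big(\sum_{k\ge0}\ \sup_{2^k\le t<2^{k+1}}|A_tf-\mathbb E_kf|^2\Big)^{1/2},$$ $$\mathcal S^S_{\mathcal A}f=\Big(\sum_{k\ge0}\ \sup_{2^k\le t_0<t_1<\dots<t_N<2^{k+1}}\ \sum_{i=0}^{N-1}|A_{t_i}f-A_{t_{i+1}}f|^2\Big)^{1/2}$$ (the last supremum being over all finite increasing sequences of integers, of any length) satisfy $$\|\mathcal S^L_{\mathcal A}f\|_{L^p(\mathbb Z^d)}\le C\|f\|_{L^p(\mathbb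 Z^d)},\qquad \|\mathcal S^S_{\mathcal A}f\|_{L^p(\mathbb Z^d)}\le C\|f\|_{L^p(\mathbb Z^d)}$$ for every $f\in L^p(\mathbb Z^d)$, $f:\mathbb Z^d\to\mathbb C$. -/

import Mathlib

open scoped ENNReal NNReal

namespace JRW

/-- The dyadic exponents `a k i` of the rectangles `R_k = ∏ i, [0, 2 ^ a k i)` in `ℤ^d`:
`R_0 = {0}`, the exponents are non-decreasing in `k`, and at each step at least one of them
strictly increases. -/
structure IsDyadicScale {d : ℕ} (a : ℕ → Fin d → ℕ) : Prop where
  zero : ∀ i, a 0 i = 0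
  mono : ∀ k i, a k i ≤ a (k + 1) i
  strict : ∀ k, ∃ i, a k i < a (k + 1) i

/-- The symmetric rectangle `H_k = ∏ i, [-2 ^ a k i, 2 ^ a k i)`. -/
noncomputable def rect {d : ℕ} (a : ℕ → Fin d → ℕ) (k : ℕ) : Finset (Fin d → ℤ) :=
  Fintype.piFinset fun i => Finset.Ico (-(2 : ℤ) ^ a k i) (2 ^ a k i)

/-- The atom of `σ_k` containing `x`: the rectangle `∏ i, 2 ^ a k i • [m i, m i + 1)`, where
`m i = ⌊x i / 2 ^ a k i⌋`. -/
noncomputable def atom {d : ℕ} (a : ℕ → Fin d → ℕ) (k : ℕ) (x : Fin d → ℤ) : Finset (Fin d → ℤ) :=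
  Fintype.piFinset fun i =>
    Finset.Ico (2 ^ a k i * (x i / 2 ^ a k i)) (2 ^ a k i * (x i / 2 ^ a k i + 1))

/-- Every point lies in its atom. -/
theorem mem_atom {d : ℕ} (a : ℕ → Fin d → ℕ) (k : ℕ) (x : Fin d → ℤ) : x ∈ atom a k x := by
  simp only [atom, Fintype.mem_piFinset, Finset.mem_Ico]
  intro i
  have h : (0 : ℤ) < 2 ^ a k i := by positivity
  have h1 := Int.mul_ediv_add_emod (x i) (2 ^ a k i)
  have h2 := Int.emod_nonneg (x i) h.ne'
  have h3 := Int.emod_lt_of_pos (x i) h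
  constructor
  · linarith
  · rw [mul_add, mul_one]
    linarith

/-- The expectation `𝔼_k f` with respect to `σ_k`: the average of `f` over the atom of `x`. -/
noncomputable def expect {d : ℕ} (a : ℕ → Fin d → ℕ) (k : ℕ) (f : (Fin d → ℤ) → ℂ)
    (x : Fin d → ℤ) : ℂ :=
  (∑ y ∈ atom a k x, f y) / ((atom a k x).card : ℂ)

/-- The discrete boundary `∂E`: the points of `E` with a nearest neighbour outside `E`. -/
def boundary {d : ℕ} (E : Finset (Fin d → ℤ)) : Set (Fin d → ℤ) :=
  {x | x ∈ E ∧ ∃ i, x + Pi.single i 1 ∉ E ∨ x - Pi.single i 1 ∉ E}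

/-- The set `{x : ∂E ∩ (H - x) ≠ ∅}`. -/
def boundaryLayer {d : ℕ} (E H : Finset (Fin d → ℤ)) : Set (Fin d → ℤ) :=
  {x | ∃ h ∈ H, h - x ∈ boundary E}

/-- The boundary layer is finite. -/
theorem finite_boundaryLayer {d : ℕ} (E H : Finset (Fin d → ℤ)) :
    (boundaryLayer E H).Finite := by
  refine Set.Finite.subset ((H ×ˢ E).image fun q => q.1 - q.2).finite_toSet ?_
  rintro x ⟨h, hh, hx, -⟩
  simp only [Finset.coe_image, Set.mem_image, Finset.mem_coe, Finset.mem_product]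
  exact ⟨(h, h - x), ⟨hh, hx⟩, by simp⟩

/-- `B(E, H) = |{x : ∂E ∩ (H - x) ≠ ∅}|`. -/
noncomputable def B {d : ℕ} (E H : Finset (Fin d → ℤ)) : ℕ :=
  (boundaryLayer E H).ncard

/-- The location, size, smoothness and eccentricity criteria for the collections `𝒜 k`,
with size constant `c`, smoothness sequence `ι` and eccentricity sequence `ε`. -/
structure Criteria {d : ℕ} (a : ℕ → Fin d → ℕ) (𝒜 : ℕ → Set (Finset (Fin d → ℤ)))
    (c : ℝ) (ι ε : ℕ → ℝ≥0) : Prop where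
  c_pos : 0 < c
  summable_smoothness : Summable ι
  summable_eccentricity : Summable ε
  location : ∀ k, ∀ E ∈ 𝒜 k, E ⊆ rect a k
  size : ∀ k, ∀ E ∈ 𝒜 k, c * ((rect a k).card : ℝ) ≤ (E.card : ℝ)
  smoothness : ∀ k l, ∀ E ∈ 𝒜 (k + l),
    (B E (rect a k) : ℝ) / ((rect a (k + l)).card : ℝ) ≤ (ι l : ℝ) ^ 2
  eccentricity : ∀ k l,
    (B (rect a (k + l)) (rect a k) : ℝ) / ((rect a (k + l)).card : ℝ) ≤ (ε l : ℝ) ^ 2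

/-- The dyadic block of indices `2 ^ k ≤ t < 2 ^ (k + 1)`. -/
def block (k : ℕ) : Set ℕ := Set.Ico (2 ^ k) (2 ^ (k + 1))

/-- The family `E_t`, `t ≥ 1`, is regular with respect to `𝒜`: inside each dyadic block it is
nested, and its members with index in the `k`-th block belong to `𝒜 k`. -/
def IsRegularFamily {d : ℕ} (𝒜 : ℕ → Set (Finset (Fin d → ℤ)))
    (E : ℕ → Finset (Fin d → ℤ)) : Prop :=
  ∀ k, ∀ t ∈ block k, ∀ t' ∈ block k, t ≤ t' → E t ⊆ E t' ∧ E t ∈ 𝒜 k ∧ E t' ∈ 𝒜 k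

/-- The averaging operator `A f x = |E|⁻¹ ∑ y ∈ E, f (x - y)`. -/
noncomputable def avg {d : ℕ} (E : Finset (Fin d → ℤ)) (f : (Fin d → ℤ) → ℂ)
    (x : Fin d → ℤ) : ℂ :=
  (∑ y ∈ E, f (x - y)) / (E.card : ℂ)

/-- The long square function
`(∑ k, sup_{2 ^ k ≤ t < 2 ^ (k + 1)} |A_t f - 𝔼_k f| ^ 2) ^ (1 / 2)`, valued in `[0, ∞]`. -/
noncomputable def longSquare {d : ℕ} (a : ℕ → Fin d → ℕ) (E : ℕ → Finset (Fin d → ℤ))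
    (f : (Fin d → ℤ) → ℂ) (x : Fin d → ℤ) : ℝ≥0∞ :=
  (∑' k : ℕ, ⨆ t ∈ block k, ‖avg (E t) f x - expect a k f x‖ₑ ^ 2) ^ (1 / 2 : ℝ)

/-- The short square function
`(∑ k, sup ∑ i, |A_{t_i} f - A_{t_{i+1}} f| ^ 2) ^ (1 / 2)`, valued in `[0, ∞]`; the supremum is
over all finite increasing sequences `t_0 < ⋯ < t_N` in the `k`-th dyadic block. -/
noncomputable def shortSquare {d : ℕ} (E : ℕ → Finset (Fin d → ℤ))
    (f : (Fin d → ℤ) → ℂ) (x : Fin d → ℤ) : ℝ≥0∞ :=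
  (∑' k : ℕ, ⨆ (N : ℕ) (t : ℕ → ℕ) (_ : StrictMono t) (_ : ∀ i ≤ N, t i ∈ block k),
    ∑ i ∈ Finset.range N, ‖avg (E (t i)) f x - avg (E (t (i + 1))) f x‖ₑ ^ 2) ^ (1 / 2 : ℝ)

end JRW

/-! Both square functions have the form $(\sum_k V_k)^{1/2}$. As $p>2$, put $q=p/2$ with conjugate
exponent $s$; by the converse of Hölder's inequality it is enough to bound $\sum_x\sum_k V_k h$ by a
constant times $\|f\|_p^2\|h\|_s$ for every weight $h\ge0$ (`tsum_tsum_mul_le`,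
`exists_eLpNorm_le`).

For a cutoff $N\ge k$ write $f=\sum_{n\le N}d_n$, where $d_n=\mathbb E_nf-\mathbb E_{n+1}f$ for
$n<N$ and $d_N=\mathbb E_Nf$. The effect of $d_n$ at scale $k$ decays in $|k-n|$, for two different
reasons. If $n<k$, then $d_n$ has mean zero on each atom of $\sigma_{n+1}$, so in a sum over $x-E$
only atoms crossing the boundary survive. Smoothness counts them, and Cauchy–Schwarz gives the
factor $\iota(k-n-1)^2$. For the short variation the same count applies to the differences of nested
sets, and the resulting bounds telescope (`sum_norm_avg_sub_sq_le`). If $n\ge k$, then $d_n$ is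
constant on atoms of $\sigma_n$, so there is no contribution unless $x$ is close, at scale $k$, to a
face of its $n$-atom. Since $\varepsilon(L)<1$ for some $L$, every side at least doubles in $L$
steps, so such bad points have density $O(2^{-\lfloor(n-k)/L\rfloor})$ (`eexp_bad_le`). Hölder's
inequality with an exponent $1<r<s$ keeps a power of this density and replaces $h$ by the weight
$w=(M(h^r))^{1/r}$.

A Schur-type sum over $k$ and $n$ leaves $\sum_n\sum_x|d_n|^2w$. This is at most $5\sum_x(Mf)^2Mw$
(`sum_tsum_enorm_diff_sq_mul_le`), and Hölder's inequality with the maximal inequalities for $Mf$ in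
$L^p$, $Mw$ in $L^s$ and $M(h^r)$ in $L^{s/r}$ finishes the proof. -/

namespace JRW

variable {d : ℕ} {a : ℕ → Fin d → ℕ}

/-! ### Atoms and their neighbourhoods -/

/-- The common cardinality of the atoms of `σ_k`. -/
def vol (a : ℕ → Fin d → ℕ) (k : ℕ) : ℕ := ∏ i, 2 ^ a k i

theorem vol_pos (a : ℕ → Fin d → ℕ) (k : ℕ) : 0 < vol a k :=
  Finset.prod_pos fun _ _ => by positivity

theorem vol_ne_zero (a : ℕ → Fin d → ℕ) (k : ℕ) : (vol a k : ℝ≥0∞) ≠ 0 := by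
  exact_mod_cast (vol_pos a k).ne'

theorem vol_ne_top (a : ℕ → Fin d → ℕ) (k : ℕ) : (vol a k : ℝ≥0∞) ≠ ∞ :=
  ENNReal.natCast_ne_top _

theorem card_atom (a : ℕ → Fin d → ℕ) (k : ℕ) (x : Fin d → ℤ) :
    (atom a k x).card = vol a k := by
  rw [atom, Fintype.card_piFinset, vol]
  refine Finset.prod_congr rfl fun i _ => ?_
  rw [Int.card_Ico, mul_add, mul_one, add_sub_cancel_left]
  exact_mod_cast Int.toNat_natCast _

theorem card_rect (a : ℕ → Fin d → ℕ) (k : ℕ) : (rect a k).card = 2 ^ d * vol a k := by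
  rw [rect, Fintype.card_piFinset, vol]
  have : ∀ i, (Finset.Ico (-(2 : ℤ) ^ a k i) (2 ^ a k i)).card = 2 * 2 ^ a k i := by
    intro i
    rw [Int.card_Ico, sub_neg_eq_add, ← two_mul]
    exact_mod_cast Int.toNat_natCast _
  simp [this, Finset.prod_mul_distrib]

theorem mem_atom_iff {k : ℕ} {x y : Fin d → ℤ} :
    y ∈ atom a k x ↔ ∀ i, y i / 2 ^ a k i = x i / 2 ^ a k i := by
  simp only [atom, Fintype.mem_piFinset, Finset.mem_Ico]
  refine forall_congr' fun i => ?_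
  have h : (0 : ℤ) < 2 ^ a k i := by positivity
  rw [mul_comm, ← Int.le_ediv_iff_mul_le h, mul_comm, ← Int.ediv_lt_iff_lt_mul h]
  omega

/-- The union of the atoms of `σ_k` that are equal or adjacent to the atom of `x`. -/
noncomputable def nbr (a : ℕ → Fin d → ℕ) (k : ℕ) (x : Fin d → ℤ) : Finset (Fin d → ℤ) :=
  Fintype.piFinset fun i =>
    Finset.Ico (2 ^ a k i * (x i / 2 ^ a k i - 1)) (2 ^ a k i * (x i / 2 ^ a k i + 2))

theorem mem_nbr_iff {k : ℕ} {x y : Fin d → ℤ} :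
    y ∈ nbr a k x ↔
      ∀ i, x i / 2 ^ a k i ≤ y i / 2 ^ a k i + 1 ∧ y i / 2 ^ a k i ≤ x i / 2 ^ a k i + 1 := by
  simp only [nbr, Fintype.mem_piFinset, Finset.mem_Ico]
  refine forall_congr' fun i => ?_
  have h : (0 : ℤ) < 2 ^ a k i := by positivity
  rw [mul_comm, ← Int.le_ediv_iff_mul_le h, mul_comm, ← Int.ediv_lt_iff_lt_mul h]
  omega

theorem card_nbr (a : ℕ → Fin d → ℕ) (k : ℕ) (x : Fin d → ℤ) :
    (nbr a k x).card = 3 ^ d * vol a k := by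
  rw [nbr, Fintype.card_piFinset, vol]
  have : ∀ i, (Finset.Ico ((2 : ℤ) ^ a k i * (x i / 2 ^ a k i - 1))
      (2 ^ a k i * (x i / 2 ^ a k i + 2))).card = 3 * 2 ^ a k i := by
    intro i
    rw [Int.card_Ico, ← mul_sub, show x i / 2 ^ a k i + 2 - (x i / 2 ^ a k i - 1) = 3 by ring,
      mul_comm]
    exact_mod_cast Int.toNat_natCast _
  simp [this, Finset.prod_mul_distrib]

theorem mem_atom_comm {k : ℕ} {x y : Fin d → ℤ} : y ∈ atom a k x ↔ x ∈ atom a k y := by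
  simp only [mem_atom_iff, eq_comm]

theorem atom_eq {k : ℕ} {x y : Fin d → ℤ} (h : y ∈ atom a k x) : atom a k y = atom a k x := by
  ext z
  simp only [mem_atom_iff] at *
  simp only [h]

theorem mem_nbr_comm {k : ℕ} {x y : Fin d → ℤ} : y ∈ nbr a k x ↔ x ∈ nbr a k y := by
  simp only [mem_nbr_iff, and_comm]

theorem nbr_eq {k : ℕ} {x y : Fin d → ℤ} (h : y ∈ atom a k x) : nbr a k y = nbr a k x := by
  ext z
  simp only [mem_nbr_iff]
  simp only [mem_atom_iff] at h
  simp only [h]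

theorem atom_subset_nbr {k : ℕ} {x y : Fin d → ℤ} (h : y ∈ nbr a k x) :
    atom a k y ⊆ nbr a k x := by
  intro z hz
  rw [mem_nbr_comm] at h ⊢
  rwa [nbr_eq hz]

theorem mem_nbr_self (k : ℕ) (x : Fin d → ℤ) : x ∈ nbr a k x := by
  rw [mem_nbr_iff]
  intro i
  omega

theorem ediv_pow_of_le (z : ℤ) {m n : ℕ} (h : m ≤ n) :
    z / 2 ^ n = z / 2 ^ m / 2 ^ (n - m) := by
  rw [Int.ediv_ediv_of_nonneg (by positivity), ← pow_add, Nat.add_sub_cancel' h]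

theorem atom_mono (ha : Monotone a) {k j : ℕ} (h : k ≤ j) (x : Fin d → ℤ) :
    atom a k x ⊆ atom a j x := by
  intro y
  simp only [mem_atom_iff]
  intro hy i
  rw [ediv_pow_of_le _ (ha h i), hy i, ← ediv_pow_of_le _ (ha h i)]

theorem nbr_mono (ha : Monotone a) {k j : ℕ} (h : k ≤ j) (x : Fin d → ℤ) :
    nbr a k x ⊆ nbr a j x := by
  intro y
  simp only [mem_nbr_iff]
  intro hy i
  rw [ediv_pow_of_le (x i) (ha h i), ediv_pow_of_le (y i) (ha h i)]
  have hp : (1 : ℤ) ≤ 2 ^ (a j i - a k i) := one_le_pow₀ (by norm_num)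
  have key : ∀ u v : ℤ, u ≤ v + 1 →
      u / 2 ^ (a j i - a k i) ≤ v / 2 ^ (a j i - a k i) + 1 := by
    intro u v huv
    rw [← Int.add_mul_ediv_right v 1 (by omega)]
    exact Int.ediv_le_ediv (by omega) (by omega)
  exact ⟨key _ _ (hy i).1, key _ _ (hy i).2⟩

/-- The reflected rectangle `x - H_k` is contained in the neighbourhood of the atom of `x`. -/
theorem sub_mem_nbr {k : ℕ} {h : Fin d → ℤ} (hh : h ∈ rect a k) (x : Fin d → ℤ) :
    x - h ∈ nbr a k x := by
  simp only [rect, Fintype.mem_piFinset, Finset.mem_Ico] at hh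
  simp only [nbr, Fintype.mem_piFinset, Finset.mem_Ico, Pi.sub_apply]
  intro i
  have hp : (0 : ℤ) < 2 ^ a k i := by positivity
  have h1 := Int.mul_ediv_add_emod (x i) (2 ^ a k i)
  have h2 := Int.emod_nonneg (x i) hp.ne'
  have h3 := Int.emod_lt_of_pos (x i) hp
  have h4 := hh i
  constructor <;> linarith

/-! ### Atomic functions and averaging operators -/

/-- Functions that are constant on the atoms of `σ_k`. -/
def IsAtomic {β : Type*} (a : ℕ → Fin d → ℕ) (k : ℕ) (g : (Fin d → ℤ) → β) : Prop :=
  ∀ x, ∀ y ∈ atom a k x, g y = g x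

theorem IsAtomic.mono {β : Type*} (ha : Monotone a) {k j : ℕ} (h : k ≤ j)
    {g : (Fin d → ℤ) → β} (hg : IsAtomic a j g) : IsAtomic a k g :=
  fun x y hy => hg x y (atom_mono ha h x hy)

theorem IsAtomic.comp {β γ : Type*} {k : ℕ} {g : (Fin d → ℤ) → β} (hg : IsAtomic a k g)
    (φ : β → γ) : IsAtomic a k fun x => φ (g x) :=
  fun x y hy => congrArg φ (hg x y hy)

theorem IsAtomic.comp₂ {β γ δ : Type*} {k : ℕ} {g : (Fin d → ℤ) → β} {h : (Fin d → ℤ) → γ}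
    (hg : IsAtomic a k g) (hh : IsAtomic a k h) (φ : β → γ → δ) :
    IsAtomic a k fun x => φ (g x) (h x) :=
  fun x y hy => by simp only [hg x y hy, hh x y hy]

/-- Double counting: a coarse atom is a union of fine ones, and each $z$ is counted once for every
point of its own fine atom. -/
theorem sum_atom_sum_atom {β : Type*} [AddCommMonoid β] (ha : Monotone a) {k j : ℕ} (h : k ≤ j)
    (x : Fin d → ℤ) (g : (Fin d → ℤ) → β) :
    ∑ y ∈ atom a j x, ∑ z ∈ atom a k y, g z = vol a k • ∑ z ∈ atom a j x, g z := by
  rw [Finset.sum_comm' (t' := atom a j x) (s' := fun z => atom a k z)]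
  · simp [card_atom, Finset.smul_sum]
  · intro y z
    constructor
    · rintro ⟨hy, hz⟩
      exact ⟨mem_atom_comm.1 hz, by rw [← atom_eq hy]; exact atom_mono ha h y hz⟩
    · rintro ⟨hy, hz⟩
      exact ⟨by rw [← atom_eq hz]; exact atom_mono ha h z hy, mem_atom_comm.1 hy⟩

theorem sum_nbr_sum_atom {β : Type*} [AddCommMonoid β] {k : ℕ}
    (x : Fin d → ℤ) (g : (Fin d → ℤ) → β) :
    ∑ y ∈ nbr a k x, ∑ z ∈ atom a k y, g z = vol a k • ∑ z ∈ nbr a k x, g z := by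
  rw [Finset.sum_comm' (t' := nbr a k x) (s' := fun z => atom a k z)]
  · simp [card_atom, Finset.smul_sum]
  · intro y z
    constructor
    · rintro ⟨hy, hz⟩
      exact ⟨mem_atom_comm.1 hz, atom_subset_nbr hy hz⟩
    · rintro ⟨hy, hz⟩
      exact ⟨atom_subset_nbr hz hy, mem_atom_comm.1 hy⟩

/-- The expectation of `[0, ∞]`-valued functions with respect to `σ_k`. -/
noncomputable def eexp (a : ℕ → Fin d → ℕ) (k : ℕ) (g : (Fin d → ℤ) → ℝ≥0∞)
    (x : Fin d → ℤ) : ℝ≥0∞ :=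
  (∑ y ∈ atom a k x, g y) / vol a k

/-- The sum over the neighbourhood of the atom of `x`, divided by the cardinality of an atom. -/
noncomputable def nbrAvg (a : ℕ → Fin d → ℕ) (k : ℕ) (g : (Fin d → ℤ) → ℝ≥0∞)
    (x : Fin d → ℤ) : ℝ≥0∞ :=
  (∑ y ∈ nbr a k x, g y) / vol a k

theorem isAtomic_eexp (k : ℕ) (g : (Fin d → ℤ) → ℝ≥0∞) : IsAtomic a k (eexp a k g) :=
  fun x y hy => by simp only [eexp, atom_eq hy]

theorem isAtomic_expect (k : ℕ) (f : (Fin d → ℤ) → ℂ) : IsAtomic a k (expect a k f) :=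
  fun x y hy => by simp only [expect, atom_eq hy]

theorem eexp_mono (k : ℕ) {g h : (Fin d → ℤ) → ℝ≥0∞} (hgh : ∀ x, g x ≤ h x) (x : Fin d → ℤ) :
    eexp a k g x ≤ eexp a k h x :=
  ENNReal.div_le_div_right (Finset.sum_le_sum fun y _ => hgh y) _

theorem nbrAvg_mono (k : ℕ) {g h : (Fin d → ℤ) → ℝ≥0∞} (hgh : ∀ x, g x ≤ h x)
    (x : Fin d → ℤ) : nbrAvg a k g x ≤ nbrAvg a k h x :=
  ENNReal.div_le_div_right (Finset.sum_le_sum fun y _ => hgh y) _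

theorem eexp_of_isAtomic {k : ℕ} {g : (Fin d → ℤ) → ℝ≥0∞} (hg : IsAtomic a k g)
    (x : Fin d → ℤ) : eexp a k g x = g x := by
  rw [eexp, Finset.sum_congr rfl (hg x), Finset.sum_const, card_atom, nsmul_eq_mul, mul_comm,
    ENNReal.mul_div_cancel_right (vol_ne_zero a k) (vol_ne_top a k)]

theorem eexp_eexp (ha : Monotone a) {k j : ℕ} (h : k ≤ j) (g : (Fin d → ℤ) → ℝ≥0∞)
    (x : Fin d → ℤ) : eexp a j (eexp a k g) x = eexp a j g x := by
  simp only [eexp, div_eq_mul_inv]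
  rw [← Finset.sum_mul, sum_atom_sum_atom ha h, nsmul_eq_mul, mul_comm (vol a k : ℝ≥0∞),
    mul_assoc (∑ y ∈ _, g y), ENNReal.mul_inv_cancel (vol_ne_zero a k) (vol_ne_top a k), mul_one]

theorem expect_expect (ha : Monotone a) {k j : ℕ} (h : k ≤ j) (f : (Fin d → ℤ) → ℂ)
    (x : Fin d → ℤ) : expect a j (expect a k f) x = expect a j f x := by
  have hv : (vol a k : ℂ) ≠ 0 := by exact_mod_cast (vol_pos a k).ne'
  simp only [expect, card_atom]
  rw [← Finset.sum_div, sum_atom_sum_atom ha h, nsmul_eq_mul, mul_div_cancel_left₀ _ hv]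

theorem expect_of_isAtomic {k : ℕ} {f : (Fin d → ℤ) → ℂ} (hf : IsAtomic a k f)
    (x : Fin d → ℤ) : expect a k f x = f x := by
  have hv : (vol a k : ℂ) ≠ 0 := by exact_mod_cast (vol_pos a k).ne'
  rw [expect, Finset.sum_congr rfl (hf x), Finset.sum_const, card_atom, nsmul_eq_mul,
    mul_div_cancel_left₀ _ hv]

theorem nbrAvg_eexp (k : ℕ) (g : (Fin d → ℤ) → ℝ≥0∞) (x : Fin d → ℤ) :
    nbrAvg a k (eexp a k g) x = nbrAvg a k g x := by
  simp only [eexp, nbrAvg, div_eq_mul_inv]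
  rw [← Finset.sum_mul, sum_nbr_sum_atom, nsmul_eq_mul, mul_comm (vol a k : ℝ≥0∞),
    mul_assoc (∑ y ∈ _, g y), ENNReal.mul_inv_cancel (vol_ne_zero a k) (vol_ne_top a k), mul_one]

theorem nbrAvg_const (k : ℕ) (c : ℝ≥0∞) (x : Fin d → ℤ) :
    nbrAvg a k (fun _ => c) x = 3 ^ d * c := by
  rw [nbrAvg, Finset.sum_const, card_nbr, nsmul_eq_mul, Nat.cast_mul, mul_comm, ← mul_assoc,
    ENNReal.mul_div_cancel_right (vol_ne_zero a k) (vol_ne_top a k)]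
  push_cast
  ring

theorem eexp_le_nbrAvg {k : ℕ} {x y : Fin d → ℤ} (h : y ∈ nbr a k x)
    (g : (Fin d → ℤ) → ℝ≥0∞) : eexp a k g y ≤ nbrAvg a k g x :=
  ENNReal.div_le_div_right (Finset.sum_le_sum_of_subset (atom_subset_nbr h)) _

theorem tsum_sum_mul_symm {α : Type*} {s : α → Finset α} (hs : ∀ x y, y ∈ s x ↔ x ∈ s y)
    (g h : α → ℝ≥0∞) :
    ∑' x, (∑ y ∈ s x, g y) * h x = ∑' x, g x * ∑ y ∈ s x, h y := by
  classical
  have key : ∀ (g : α → ℝ≥0∞) x, ∑ y ∈ s x, g y = ∑' y, if y ∈ s x then g y else 0 := by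
    intro g x
    rw [tsum_eq_sum (s := s x) (fun y hy => if_neg hy)]
    exact Finset.sum_congr rfl fun y hy => (if_pos hy).symm
  simp only [key, ← ENNReal.tsum_mul_right, ← ENNReal.tsum_mul_left]
  rw [ENNReal.tsum_comm]
  refine tsum_congr fun x => tsum_congr fun y => ?_
  by_cases hxy : y ∈ s x
  · rw [if_pos hxy, if_pos ((hs _ _).1 hxy)]
  · rw [if_neg hxy, if_neg fun h => hxy ((hs _ _).2 h), zero_mul, mul_zero]

theorem tsum_eexp_mul (k : ℕ) (g h : (Fin d → ℤ) → ℝ≥0∞) :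
    ∑' x, eexp a k g x * h x = ∑' x, g x * eexp a k h x := by
  simp only [eexp, div_eq_mul_inv, ← mul_assoc]
  simp only [mul_right_comm _ _ (h _), ENNReal.tsum_mul_right]
  rw [tsum_sum_mul_symm fun x y => mem_atom_comm]

theorem tsum_nbrAvg_mul (k : ℕ) (g h : (Fin d → ℤ) → ℝ≥0∞) :
    ∑' x, nbrAvg a k g x * h x = ∑' x, g x * nbrAvg a k h x := by
  simp only [nbrAvg, div_eq_mul_inv, ← mul_assoc]
  simp only [mul_right_comm _ _ (h _), ENNReal.tsum_mul_right]
  rw [tsum_sum_mul_symm fun x y => mem_nbr_comm]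

/-- Self-adjointness of the expectation, which fixes $u$. This is the tool for inserting or removing
an average next to an atomic factor. -/
theorem tsum_mul_eexp {k : ℕ} {u : (Fin d → ℤ) → ℝ≥0∞} (hu : IsAtomic a k u)
    (g : (Fin d → ℤ) → ℝ≥0∞) : ∑' x, u x * eexp a k g x = ∑' x, u x * g x := by
  rw [← tsum_eexp_mul]
  simp only [eexp_of_isAtomic hu]

theorem tsum_eexp (k : ℕ) (g : (Fin d → ℤ) → ℝ≥0∞) : ∑' x, eexp a k g x = ∑' x, g x := by
  simpa using tsum_mul_eexp (a := a) (k := k) (u := fun _ => 1) (fun _ _ _ => rfl) g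

theorem tsum_nbrAvg (k : ℕ) (g : (Fin d → ℤ) → ℝ≥0∞) :
    ∑' x, nbrAvg a k g x = 3 ^ d * ∑' x, g x := by
  have := tsum_nbrAvg_mul (a := a) k g fun _ => 1
  simp only [mul_one, nbrAvg_const] at this
  rw [this, ENNReal.tsum_mul_right, mul_comm]

/-- Averaging over the neighbourhoods of scale `k` first costs a constant at a coarser scale. -/
theorem eexp_nbrAvg_le (ha : Monotone a) {k j : ℕ} (h : k ≤ j) (g : (Fin d → ℤ) → ℝ≥0∞)
    (x : Fin d → ℤ) : eexp a j (nbrAvg a k g) x ≤ 3 ^ d * nbrAvg a j g x := by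
  classical
  have hsum : ∑ y ∈ atom a j x, ∑ z ∈ nbr a k y, g z ≤
      ∑ z ∈ nbr a j x, (3 ^ d * vol a k : ℕ) * g z := by
    rw [Finset.sum_comm' (t' := nbr a j x) (s' := fun z => {y ∈ atom a j x | y ∈ nbr a k z})]
    · refine Finset.sum_le_sum fun z _ => ?_
      rw [Finset.sum_const, nsmul_eq_mul]
      gcongr
      rw [← card_nbr a k z]
      exact Finset.card_le_card fun y hy => (Finset.mem_filter.1 hy).2
    · intro y z
      rw [Finset.mem_filter, mem_nbr_comm (x := y)]
      refine ⟨fun ⟨hy, hz⟩ => ⟨⟨hy, hz⟩, ?_⟩, fun ⟨⟨hy, hz⟩, _⟩ => ⟨hy, hz⟩⟩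
      rw [← nbr_eq hy]
      exact nbr_mono ha h y (mem_nbr_comm.1 hz)
  simp only [nbrAvg, eexp]
  rw [← mul_div_assoc]
  refine ENNReal.div_le_div_right ?_ _
  simp only [div_eq_mul_inv]
  rw [← Finset.sum_mul, ← div_eq_mul_inv]
  refine ENNReal.div_le_of_le_mul (hsum.trans_eq ?_)
  rw [← Finset.mul_sum]
  push_cast
  ring

/-! ### Hölder's inequality and its converse -/

theorem tsum_mul_le_Lp_mul_Lq {α : Type*} {p q : ℝ} (hpq : p.HolderConjugate q)
    (f g : α → ℝ≥0∞) :
    ∑' x, f x * g x ≤ (∑' x, f x ^ p) ^ (1 / p) * (∑' x, g x ^ q) ^ (1 / q) := by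
  let _ : MeasurableSpace α := ⊤
  have h := ENNReal.lintegral_mul_le_Lp_mul_Lq MeasureTheory.Measure.count hpq
    (f := f) (g := g) (measurable_from_top.aemeasurable) (measurable_from_top.aemeasurable)
  simpa only [MeasureTheory.lintegral_count, Pi.mul_apply] using h

theorem rpow_le_of_le_mul_rpow {p q : ℝ} (hpq : p.HolderConjugate q) {X K : ℝ≥0∞} (hX : X ≠ ∞)
    (h : X ≤ K * X ^ (1 / q)) : X ^ (1 / p) ≤ K := by
  rcases eq_or_ne X 0 with rfl | hX0
  · simp [hpq.pos]
  have h0 : X ^ (1 / q) ≠ 0 := by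
    simp [ENNReal.rpow_eq_zero_iff, hX0, hX]
  have h1 : X ^ (1 / q) ≠ ∞ := ENNReal.rpow_ne_top_of_nonneg hpq.symm.one_div_nonneg hX
  rw [← ENNReal.mul_le_mul_iff_left h0 h1]
  refine le_trans (le_of_eq ?_) h
  rw [← ENNReal.rpow_add _ _ hX0 hX]
  have := hpq.inv_add_inv_eq_one
  simp only [one_div, this, ENNReal.rpow_one]

/-- The converse of Hölder's inequality. -/
theorem rpow_tsum_le_of_forall_tsum_mul_le {α : Type*} {p q : ℝ} (hpq : p.HolderConjugate q)
    {F : α → ℝ≥0∞} {K : ℝ≥0∞} (h : ∀ u : α → ℝ≥0∞, ∑' x, F x * u x ≤ K * (∑' x, u x ^ q) ^ (1 / q)) :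
    (∑' x, F x ^ p) ^ (1 / p) ≤ K := by
  classical
  rcases eq_or_ne K ∞ with rfl | hK
  · exact le_top
  -- Testing against a point mass excludes infinite values.
  have hF : ∀ x, F x ≠ ∞ := by
    intro x hx
    have h1 := h (Pi.single x 1)
    rw [tsum_eq_single x (fun y hy => by simp [hy]), tsum_eq_single x
      (fun y hy => by simp [hy, hpq.symm.pos])] at h1
    simp [hx, hK] at h1
  rw [one_div, ENNReal.rpow_inv_le_iff hpq.pos, ENNReal.tsum_eq_iSup_sum]
  refine iSup_le fun S => ?_
  rw [← ENNReal.rpow_inv_le_iff hpq.pos, ← one_div]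
  have hfin : ∑ x ∈ S, F x ^ p ≠ ∞ :=
    ENNReal.sum_ne_top.2 fun x _ => ENNReal.rpow_ne_top_of_nonneg hpq.nonneg (hF x)
  refine rpow_le_of_le_mul_rpow hpq hfin ?_
  -- The extremal function of Hölder's inequality, cut to a finite set so that the sum can be
  -- divided out.
  have h1 := h fun x => if x ∈ S then F x ^ (p - 1) else 0
  rw [tsum_eq_sum (s := S) (fun x hx => by simp [hx]), tsum_eq_sum (s := S)
    (fun x hx => by simp [hx, hpq.symm.pos])] at h1
  convert h1 using 1
  · refine Finset.sum_congr rfl fun x hx => ?_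
    rw [if_pos hx]
    nth_rewrite 2 [← ENNReal.rpow_one (F x)]
    rw [← ENNReal.rpow_add_of_nonneg _ _ zero_le_one hpq.sub_one_pos.le, add_sub_cancel]
  · congr 2
    refine Finset.sum_congr rfl fun x hx => ?_
    rw [if_pos hx, ← ENNReal.rpow_mul, hpq.sub_one_mul_conj]

/-! ### Doob's maximal inequality -/

/-- Both sides vanish unless $u>v$; for finite $u$, with $t=v/u$, the claim is then $1-t^s\le
m(1-t^{s-1})$. This is Bernoulli's inequality for $(t^{s-1})^m$, which is at most $t^s$ once
$(s-1)m\ge s$. -/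
theorem rpow_max_sub_rpow_le {s : ℝ} (hs : 1 < s) :
    ∃ C : ℝ≥0, C ≠ 0 ∧ ∀ u v : ℝ≥0∞,
      max u v ^ s - v ^ s ≤ C * ((max u v ^ (s - 1) - v ^ (s - 1)) * u) := by
  obtain ⟨m, hm⟩ := exists_nat_ge (s / (s - 1))
  have hm1 : s ≤ (s - 1) * m := by
    rw [div_le_iff₀ (by linarith)] at hm
    linarith
  have hm0 : (m : ℝ≥0∞) ≠ 0 := by
    rintro h
    have : (m : ℝ) = 0 := by exact_mod_cast h
    rw [this] at hm1
    linarith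
  refine ⟨m, by exact_mod_cast hm0, fun u v => ?_⟩
  rcases le_or_gt u v with huv | huv
  · simp [max_eq_right huv]
  rw [max_eq_left huv.le]
  rcases eq_or_ne u ∞ with rfl | hu
  · have h1 : v ^ (s - 1) ≠ ∞ := ENNReal.rpow_ne_top_of_nonneg (by linarith) huv.ne
    rw [ENNReal.top_rpow_of_pos (y := s - 1) (by linarith), ENNReal.top_sub h1,
      ENNReal.top_mul_top, ENNReal.mul_top (by exact_mod_cast hm0)]
    exact le_top
  lift u to ℝ≥0 using hu
  lift v to ℝ≥0 using huv.ne_top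
  have huv' : v < u := by exact_mod_cast huv
  rw [← ENNReal.coe_rpow_of_nonneg _ (by linarith), ← ENNReal.coe_rpow_of_nonneg _ (by linarith),
    ← ENNReal.coe_rpow_of_nonneg _ (by linarith), ← ENNReal.coe_rpow_of_nonneg _ (by linarith)]
  norm_cast
  rw [← NNReal.coe_le_coe, NNReal.coe_sub (NNReal.rpow_le_rpow huv'.le (by linarith))]
  push_cast [NNReal.coe_sub (NNReal.rpow_le_rpow huv'.le (by linarith : 0 ≤ s - 1))]
  have hu0 : (0 : ℝ) < u := lt_of_le_of_lt v.2 huv'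
  set t : ℝ := v / u with ht
  have ht0 : 0 ≤ t := by positivity
  have ht1 : t ≤ 1 := (div_le_one hu0).2 (by exact_mod_cast huv'.le)
  have hv : (v : ℝ) = t * u := by rw [ht]; field_simp
  have key : 1 - t ^ s ≤ m * (1 - t ^ (s - 1)) := by
    have h1 : (t ^ (s - 1)) ^ m ≤ t ^ s := by
      rw [← Real.rpow_natCast, ← Real.rpow_mul ht0]
      rcases eq_or_lt_of_le ht0 with h0 | h0
      · rw [← h0, Real.zero_rpow (by nlinarith), Real.zero_rpow (by linarith)]
      · exact Real.rpow_le_rpow_of_exponent_ge h0 ht1 hm1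
    have h2 := one_add_mul_le_pow (a := t ^ (s - 1) - 1)
      (by have := Real.rpow_nonneg ht0 (s - 1); linarith) m
    rw [add_sub_cancel] at h2
    linarith
  have hus : (u : ℝ) ^ s = u ^ (s - 1) * u := by
    rw [← Real.rpow_add_one hu0.ne']
    ring_nf
  rw [hv, Real.mul_rpow ht0 hu0.le, Real.mul_rpow ht0 hu0.le, hus]
  have : 0 ≤ (u : ℝ) ^ (s - 1) * u := by positivity
  nlinarith [mul_le_mul_of_nonneg_right key this]

theorem le_sum_tsub_add (b : ℕ → ℝ≥0∞) (k m : ℕ) :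
    b k ≤ ∑ j ∈ Finset.Ico k (k + m), (b j - b (j + 1)) + b (k + m) := by
  induction m with
  | zero => simp
  | succ m ih =>
    rw [← add_assoc, Finset.sum_Ico_succ_top (by omega), add_assoc]
    exact ih.trans (by gcongr; exact le_tsub_add)

theorem sum_tsub_le {b : ℕ → ℝ≥0∞} (hb : Antitone b) (m : ℕ) :
    ∑ j ∈ Finset.range m, (b j - b (j + 1)) ≤ b 0 := by
  suffices h : ∑ j ∈ Finset.range m, (b j - b (j + 1)) + b m ≤ b 0 from le_self_add.trans h
  induction m with
  | zero => simp
  | succ m ih =>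
    rwa [Finset.sum_range_succ, add_assoc, tsub_add_cancel_of_le (hb (Nat.le_succ m))]

/-- The maximal function over the scales `n ≤ j ≤ N`. -/
noncomputable def mx (a : ℕ → Fin d → ℕ) (N n : ℕ) (g : (Fin d → ℤ) → ℝ≥0∞)
    (x : Fin d → ℤ) : ℝ≥0∞ :=
  (Finset.Icc n N).sup fun j => eexp a j g x

theorem eexp_le_mx {N n j : ℕ} (hn : n ≤ j) (hN : j ≤ N) (g : (Fin d → ℤ) → ℝ≥0∞)
    (x : Fin d → ℤ) : eexp a j g x ≤ mx a N n g x :=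
  Finset.le_sup (f := fun j => eexp a j g x) (Finset.mem_Icc.2 ⟨hn, hN⟩)

theorem mx_of_lt {N n : ℕ} (h : N < n) (g : (Fin d → ℤ) → ℝ≥0∞) (x : Fin d → ℤ) :
    mx a N n g x = 0 := by
  simp [mx, Finset.Icc_eq_empty_of_lt h]

theorem mx_eq_max {N n : ℕ} (h : n ≤ N) (g : (Fin d → ℤ) → ℝ≥0∞) (x : Fin d → ℤ) :
    mx a N n g x = max (eexp a n g x) (mx a N (n + 1) g x) := by
  rw [mx, ← Finset.insert_Icc_succ_left_eq_Icc h, Finset.sup_insert]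
  rfl

theorem antitone_mx (N : ℕ) (g : (Fin d → ℤ) → ℝ≥0∞) (x : Fin d → ℤ) :
    Antitone fun n => mx a N n g x :=
  fun _ _ h => Finset.sup_mono (Finset.Icc_subset_Icc_left h)

theorem isAtomic_mx (ha : Monotone a) (N n : ℕ) (g : (Fin d → ℤ) → ℝ≥0∞) :
    IsAtomic a n (mx a N n g) := by
  intro x y hy
  refine Finset.sup_congr rfl fun j hj => ?_
  exact (isAtomic_eexp j g).mono ha (Finset.mem_Icc.1 hj).1 x y hy

theorem isAtomic_mx_sub (ha : Monotone a) (N n : ℕ) (g : (Fin d → ℤ) → ℝ≥0∞)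
    (φ : ℝ≥0∞ → ℝ≥0∞) : IsAtomic a n fun x => φ (mx a N n g x) - φ (mx a N (n + 1) g x) :=
  (isAtomic_mx ha N n g).comp₂ ((isAtomic_mx ha N (n + 1) g).mono ha n.le_succ)
    fun u v => φ u - φ v

/-- Telescoping up to $N+1$, where the maximum runs over an empty range and is $0$. The increment at
$j$ is atomic at scale $j$, which is what makes the decomposition useful. -/
theorem rpow_mx_le_sum {N k : ℕ} (hk : k ≤ N) {s : ℝ} (hs : 0 < s) (g : (Fin d → ℤ) → ℝ≥0∞)
    (x : Fin d → ℤ) : mx a N k g x ^ s ≤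
      ∑ j ∈ Finset.Ico k (N + 1), (mx a N j g x ^ s - mx a N (j + 1) g x ^ s) := by
  have h := le_sum_tsub_add (fun n => mx a N n g x ^ s) k (N + 1 - k)
  rwa [Nat.add_sub_cancel' (by omega), mx_of_lt N.lt_succ_self, ENNReal.zero_rpow_of_pos hs,
    add_zero] at h

theorem rpow_eexp_le {s : ℝ} (hs : 1 ≤ s) (k : ℕ) (g : (Fin d → ℤ) → ℝ≥0∞) (x : Fin d → ℤ) :
    eexp a k g x ^ s ≤ eexp a k (fun y => g y ^ s) x := by
  have h := ENNReal.rpow_arith_mean_le_arith_mean_rpow (atom a k x)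
    (fun _ => (vol a k : ℝ≥0∞)⁻¹) g ?_ hs
  · simpa only [← Finset.mul_sum, eexp, ENNReal.div_eq_inv_mul] using h
  · rw [Finset.sum_const, card_atom, nsmul_eq_mul,
      ENNReal.mul_inv_cancel (vol_ne_zero a k) (vol_ne_top a k)]

/-- **Doob's maximal inequality** in `L^s`. -/
theorem tsum_rpow_mx_le {s : ℝ} (hs : 1 < s) :
    ∃ C : ℝ≥0, ∀ {d : ℕ} (a : ℕ → Fin d → ℕ), Monotone a → ∀ (N : ℕ)
      (g : (Fin d → ℤ) → ℝ≥0∞), ∑' x, mx a N 0 g x ^ s ≤ C * ∑' x, g x ^ s := by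
  obtain ⟨C, hC0, hC⟩ := rpow_max_sub_rpow_le hs
  have hs0 : 0 < s := by linarith
  have hconj := (Real.HolderConjugate.conjExponent hs)
  set t := s.conjExponent
  refine ⟨C ^ s, fun {d} a ha N g => ?_⟩
  rcases eq_or_ne (∑' x, g x ^ s) ∞ with htop | htop
  · rw [htop, ENNReal.mul_top]
    · exact le_top
    · simp [hC0]
  -- Finiteness is needed to divide by a power of this sum at the end; it holds because only
  -- finitely many scales occur.
  have hfin : ∑' x, mx a N 0 g x ^ s ≠ ∞ := by
    have h1 : ∀ x, mx a N 0 g x ^ s ≤ ∑ k ∈ Finset.Icc 0 N, eexp a k (fun y => g y ^ s) x := by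
      intro x
      rw [← ENNReal.le_rpow_inv_iff hs0]
      refine Finset.sup_le fun k hk => ?_
      rw [ENNReal.le_rpow_inv_iff hs0]
      exact (rpow_eexp_le hs.le k g x).trans
        (Finset.single_le_sum (f := fun k => eexp a k (fun y => g y ^ s) x)
          (fun _ _ => zero_le) hk)
    refine ne_top_of_le_ne_top ?_ (ENNReal.tsum_le_tsum h1)
    rw [Summable.tsum_finsetSum fun _ _ => ENNReal.summable]
    simp only [tsum_eexp]
    exact ENNReal.sum_ne_top.2 fun _ _ => htop
  have hmain : ∑' x, mx a N 0 g x ^ s ≤ C * ∑' x, g x * mx a N 0 g x ^ (s - 1) := by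
    calc ∑' x, mx a N 0 g x ^ s
        ≤ ∑' x, ∑ j ∈ Finset.range (N + 1),
            (mx a N j g x ^ s - mx a N (j + 1) g x ^ s) := by
          refine ENNReal.tsum_le_tsum fun x => ?_
          simpa using rpow_mx_le_sum (Nat.zero_le N) hs0 g x
      _ ≤ ∑' x, ∑ j ∈ Finset.range (N + 1),
            C * ((mx a N j g x ^ (s - 1) - mx a N (j + 1) g x ^ (s - 1)) * eexp a j g x) := by
          refine ENNReal.tsum_le_tsum fun x => Finset.sum_le_sum fun j hj => ?_
          -- The maximum changes between $j+1$ and $j$ only where it equals $\mathbb E_jg$, so the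
          -- factor $u$ of the scalar inequality is $\mathbb E_jg$.
          rw [mx_eq_max (by simpa [Nat.lt_succ_iff] using hj)]
          exact hC _ _
      _ = ∑ j ∈ Finset.range (N + 1), C * ∑' x,
            (mx a N j g x ^ (s - 1) - mx a N (j + 1) g x ^ (s - 1)) * g x := by
          rw [Summable.tsum_finsetSum fun _ _ => ENNReal.summable]
          refine Finset.sum_congr rfl fun j _ => ?_
          rw [ENNReal.tsum_mul_left, tsum_mul_eexp (isAtomic_mx_sub ha N j g fun u => u ^ (s - 1))]
      _ = C * ∑' x, g x * ∑ j ∈ Finset.range (N + 1),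
            (mx a N j g x ^ (s - 1) - mx a N (j + 1) g x ^ (s - 1)) := by
          rw [← Finset.mul_sum, ← Summable.tsum_finsetSum fun _ _ => ENNReal.summable]
          simp only [Finset.mul_sum, mul_comm]
      _ ≤ _ := by
          gcongr with x
          exact sum_tsub_le (b := fun n => mx a N n g x ^ (s - 1))
            (fun _ _ h => ENNReal.rpow_le_rpow (antitone_mx N g x h) (by linarith)) (N + 1)
  have hholder := tsum_mul_le_Lp_mul_Lq hconj g fun x => mx a N 0 g x ^ (s - 1)
  simp only [← ENNReal.rpow_mul, hconj.sub_one_mul_conj] at hholder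
  have := rpow_le_of_le_mul_rpow hconj hfin
    ((hmain.trans (mul_le_mul_right hholder _)).trans_eq (mul_assoc _ _ _).symm)
  rw [one_div, ENNReal.rpow_inv_le_iff hs0, ENNReal.mul_rpow_of_nonneg _ _ hs0.le,
    ← ENNReal.rpow_mul, inv_mul_cancel₀ hs0.ne', ENNReal.rpow_one] at this
  rwa [ENNReal.coe_rpow_of_nonneg _ hs0.le]

/-! ### The maximal function over neighbourhoods -/

/-- The maximal function of the neighbourhood averages over the scales `k ≤ N`. -/
noncomputable def nbrMax (a : ℕ → Fin d → ℕ) (N : ℕ) (g : (Fin d → ℤ) → ℝ≥0∞)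
    (x : Fin d → ℤ) : ℝ≥0∞ :=
  (Finset.range (N + 1)).sup fun k => nbrAvg a k g x

/-- The right side does not depend on $k$, so it dominates the maximal function, and summing it over
$x$ costs only $3^d$ before the increments telescope. This replaces a covering argument. -/
theorem rpow_nbrAvg_le (ha : Monotone a) {N k : ℕ} (hk : k ≤ N) {s : ℝ} (hs : 0 < s)
    (g : (Fin d → ℤ) → ℝ≥0∞) (x : Fin d → ℤ) :
    nbrAvg a k g x ^ s ≤ (3 ^ d) ^ s * ∑ j ∈ Finset.range (N + 1),
      nbrAvg a j (fun y => mx a N j g y ^ s - mx a N (j + 1) g y ^ s) x := by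
  set T := ∑ j ∈ Finset.range (N + 1),
      nbrAvg a j (fun y => mx a N j g y ^ s - mx a N (j + 1) g y ^ s) x with hT
  have h1 : ∀ y ∈ nbr a k x, eexp a k g y ≤ T ^ s⁻¹ := by
    intro y hy
    rw [ENNReal.le_rpow_inv_iff hs]
    calc eexp a k g y ^ s ≤ mx a N k g y ^ s :=
          ENNReal.rpow_le_rpow (eexp_le_mx le_rfl hk g y) hs.le
      _ ≤ _ := rpow_mx_le_sum hk hs g y
      _ ≤ ∑ j ∈ Finset.Ico k (N + 1),
            nbrAvg a j (fun y => mx a N j g y ^ s - mx a N (j + 1) g y ^ s) x := by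
          refine Finset.sum_le_sum fun j hj => ?_
          -- The increment at $j$ equals its own $j$-average at $y$, and the $j$-atom of $y$ lies in
          -- the $j$-neighbourhood of $x$.
          rw [← eexp_of_isAtomic (isAtomic_mx_sub ha N j g fun u => u ^ s) y]
          exact eexp_le_nbrAvg (nbr_mono ha (Finset.mem_Ico.1 hj).1 x hy) _
      _ ≤ T := Finset.sum_le_sum_of_subset fun j hj => by
          rw [Finset.mem_range]; exact (Finset.mem_Ico.1 hj).2
  have h2 : nbrAvg a k g x ≤ 3 ^ d * T ^ s⁻¹ := by
    rw [← nbrAvg_eexp, ← nbrAvg_const k (T ^ s⁻¹) x]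
    exact ENNReal.div_le_div_right (Finset.sum_le_sum h1) _
  calc _ ≤ (3 ^ d * T ^ s⁻¹) ^ s := ENNReal.rpow_le_rpow h2 hs.le
    _ = _ := by
      rw [ENNReal.mul_rpow_of_nonneg _ _ hs.le, ← ENNReal.rpow_mul, inv_mul_cancel₀ hs.ne',
        ENNReal.rpow_one]

theorem tsum_rpow_nbrMax_le (d : ℕ) {s : ℝ} (hs : 1 < s) :
    ∃ C : ℝ≥0, ∀ (a : ℕ → Fin d → ℕ), Monotone a → ∀ (N : ℕ)
      (g : (Fin d → ℤ) → ℝ≥0∞), ∑' x, nbrMax a N g x ^ s ≤ C * ∑' x, g x ^ s := by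
  obtain ⟨C, hC⟩ := tsum_rpow_mx_le hs
  have hs0 : 0 < s := by linarith
  refine ⟨(3 ^ d) ^ s * (3 ^ d * C), fun a ha N g => ?_⟩
  calc ∑' x, nbrMax a N g x ^ s
      ≤ ∑' x, (3 ^ d) ^ s * ∑ j ∈ Finset.range (N + 1),
          nbrAvg a j (fun y => mx a N j g y ^ s - mx a N (j + 1) g y ^ s) x := by
        refine ENNReal.tsum_le_tsum fun x => ?_
        rw [← ENNReal.le_rpow_inv_iff hs0]
        refine Finset.sup_le fun k hk => ?_
        rw [ENNReal.le_rpow_inv_iff hs0]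
        exact rpow_nbrAvg_le ha (by simpa [Nat.lt_succ_iff] using hk) hs0 g x
    _ = (3 ^ d) ^ s * (3 ^ d * ∑' x, ∑ j ∈ Finset.range (N + 1),
          (mx a N j g x ^ s - mx a N (j + 1) g x ^ s)) := by
        rw [ENNReal.tsum_mul_left, Summable.tsum_finsetSum fun _ _ => ENNReal.summable,
          Summable.tsum_finsetSum fun _ _ => ENNReal.summable]
        simp only [tsum_nbrAvg, Finset.mul_sum]
    _ ≤ (3 ^ d) ^ s * (3 ^ d * ∑' x, mx a N 0 g x ^ s) := by
        gcongr with x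
        exact sum_tsub_le (b := fun n => mx a N n g x ^ s)
            (fun _ _ h => ENNReal.rpow_le_rpow (antitone_mx N g x h) hs0.le) (N + 1)
    _ ≤ (3 ^ d) ^ s * (3 ^ d * (C * ∑' x, g x ^ s)) := by
        gcongr
        exact hC a ha N g
    _ = _ := by
        rw [ENNReal.coe_mul, ENNReal.coe_mul, ENNReal.coe_rpow_of_nonneg _ hs0.le]
        push_cast
        ring

/-! ### Martingale differences and the weighted square function -/

theorem enorm_sq_eq_ofReal (z : ℂ) : ‖z‖ₑ ^ 2 = ENNReal.ofReal (‖z‖ ^ 2) := by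
  rw [ENNReal.ofReal_pow (norm_nonneg z), ofReal_norm]

theorem sum_enorm_sq_eq_ofReal {α : Type*} (S : Finset α) (u : α → ℂ) :
    ∑ y ∈ S, ‖u y‖ₑ ^ 2 = ENNReal.ofReal (∑ y ∈ S, ‖u y‖ ^ 2) := by
  rw [ENNReal.ofReal_sum_of_nonneg fun _ _ => by positivity]
  simp only [enorm_sq_eq_ofReal]

theorem sum_norm_sub_mean_sq {α : Type*} (S : Finset α) (u : α → ℂ) (c : ℂ)
    (h : ∑ y ∈ S, u y = S.card * c) :
    ∑ y ∈ S, ‖u y - c‖ ^ 2 + S.card * ‖c‖ ^ 2 = ∑ y ∈ S, ‖u y‖ ^ 2 := by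
  have hre : ∑ y ∈ S, (u y * (starRingEnd ℂ) c).re = S.card * ‖c‖ ^ 2 := by
    rw [← Complex.re_sum, ← Finset.sum_mul, h, mul_assoc, Complex.mul_conj, Complex.normSq_eq_norm_sq]
    norm_cast
  simp only [← Complex.normSq_eq_norm_sq, Complex.normSq_sub, Finset.sum_sub_distrib,
    Finset.sum_add_distrib, ← Finset.mul_sum, Finset.sum_const, nsmul_eq_mul]
  rw [hre, Complex.normSq_eq_norm_sq]
  ring

theorem eexp_add (k : ℕ) (g h : (Fin d → ℤ) → ℝ≥0∞) (x : Fin d → ℤ) :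
    eexp a k (fun y => g y + h y) x = eexp a k g x + eexp a k h x := by
  simp only [eexp, Finset.sum_add_distrib, ENNReal.add_div]

theorem expect_sub (k : ℕ) (f g : (Fin d → ℤ) → ℂ) (x : Fin d → ℤ) :
    expect a k (fun y => f y - g y) x = expect a k f x - expect a k g x := by
  simp only [expect, Finset.sum_sub_distrib, sub_div]

theorem enorm_expect_le (k : ℕ) (f : (Fin d → ℤ) → ℂ) (x : Fin d → ℤ) :
    ‖expect a k f x‖ₑ ≤ eexp a k (fun y => ‖f y‖ₑ) x := by
  have hv : (vol a k : ℂ) ≠ 0 := by exact_mod_cast (vol_pos a k).ne'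
  rw [eexp, ENNReal.le_div_iff_mul_le (Or.inl (vol_ne_zero a k)) (Or.inl (vol_ne_top a k)),
    expect, card_atom]
  have : (vol a k : ℝ≥0∞) = ‖(vol a k : ℂ)‖ₑ := by simp [enorm_eq_nnnorm]
  rw [this, ← enorm_mul, div_mul_cancel₀ _ hv]
  exact enorm_sum_le _ _

theorem isAtomic_zero (h0 : ∀ i, a 0 i = 0) {β : Type*} (g : (Fin d → ℤ) → β) :
    IsAtomic a 0 g := by
  intro x y hy
  rw [mem_atom_iff] at hy
  congr 1
  funext i
  simpa [h0] using hy i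

/-- The martingale `𝔼_n f`, stopped at the scale `N`. -/
noncomputable def mart (a : ℕ → Fin d → ℕ) (N : ℕ) (f : (Fin d → ℤ) → ℂ) (n : ℕ)
    (x : Fin d → ℤ) : ℂ :=
  if n ≤ N then expect a n f x else 0

/-- The martingale differences: `𝔼_n f - 𝔼_{n+1} f` for `n < N` and `𝔼_N f` for `n = N`. -/
noncomputable def diff (a : ℕ → Fin d → ℕ) (N : ℕ) (f : (Fin d → ℤ) → ℂ) (n : ℕ)
    (x : Fin d → ℤ) : ℂ :=
  mart a N f n x - mart a N f (n + 1) x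

theorem sum_diff (h0 : ∀ i, a 0 i = 0) (N : ℕ) (f : (Fin d → ℤ) → ℂ) (x : Fin d → ℤ) :
    ∑ n ∈ Finset.range (N + 1), diff a N f n x = f x := by
  simp only [diff]
  rw [Finset.sum_range_sub']
  simp [mart, expect_of_isAtomic (isAtomic_zero h0 f)]

theorem isAtomic_mart (N : ℕ) (f : (Fin d → ℤ) → ℂ) (n : ℕ) : IsAtomic a n (mart a N f n) := by
  intro x y hy
  simp only [mart, isAtomic_expect n f x y hy]

theorem isAtomic_diff (ha : Monotone a) (N : ℕ) (f : (Fin d → ℤ) → ℂ) (n : ℕ) :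
    IsAtomic a n (diff a N f n) :=
  (isAtomic_mart N f n).comp₂ ((isAtomic_mart N f (n + 1)).mono ha n.le_succ) fun u v => u - v

theorem diff_of_lt {N n : ℕ} (h : n < N) (f : (Fin d → ℤ) → ℂ) :
    diff a N f n = fun x => expect a n f x - expect a (n + 1) f x := by
  funext x
  simp [diff, mart, h.le, Nat.succ_le_iff.2 h]

theorem expect_diff (ha : Monotone a) {N n k : ℕ} (h : n < N) (hk : n < k)
    (f : (Fin d → ℤ) → ℂ) (x : Fin d → ℤ) : expect a k (diff a N f n) x = 0 := by
  rw [diff_of_lt h, expect_sub, expect_expect ha hk.le, expect_expect ha (Nat.succ_le_iff.2 hk),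
    sub_self]

theorem enorm_mart_le {N n : ℕ} (f : (Fin d → ℤ) → ℂ) (x : Fin d → ℤ) :
    ‖mart a N f n x‖ₑ ≤ mx a N 0 (fun y => ‖f y‖ₑ) x := by
  rw [mart]
  split_ifs with h
  · exact (enorm_expect_le n f x).trans (eexp_le_mx (Nat.zero_le n) h _ x)
  · simp

theorem enorm_diff_sq_le (N n : ℕ) (f : (Fin d → ℤ) → ℂ) (x : Fin d → ℤ) :
    ‖diff a N f n x‖ₑ ^ 2 ≤ 4 * mx a N 0 (fun y => ‖f y‖ₑ) x ^ 2 := by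
  have h : ‖diff a N f n x‖ₑ ≤ 2 * mx a N 0 (fun y => ‖f y‖ₑ) x := by
    rw [two_mul]
    exact enorm_sub_le.trans (add_le_add (enorm_mart_le f x) (enorm_mart_le f x))
  calc _ ≤ (2 * mx a N 0 (fun y => ‖f y‖ₑ) x) ^ 2 := by gcongr
    _ = _ := by rw [mul_pow]; norm_num

/-- Pythagoras on one atom of $\sigma_{n+1}$: there $d_n$ is $\mathbb E_nf$ minus its mean. -/
theorem eexp_enorm_diff_sq (ha : Monotone a) {N n : ℕ} (h : n < N) (f : (Fin d → ℤ) → ℂ)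
    (x : Fin d → ℤ) :
    eexp a (n + 1) (fun y => ‖diff a N f n y‖ₑ ^ 2) x + ‖expect a (n + 1) f x‖ₑ ^ 2 =
      eexp a (n + 1) (fun y => ‖expect a n f y‖ₑ ^ 2) x := by
  set c := expect a (n + 1) f x with hc
  have h1 : ∑ y ∈ atom a (n + 1) x, expect a n f y = (atom a (n + 1) x).card * c := by
    have hv : ((atom a (n + 1) x).card : ℂ) ≠ 0 := by
      rw [card_atom]; exact_mod_cast (vol_pos a (n + 1)).ne'
    rw [hc, ← expect_expect ha n.le_succ, expect]
    field_simp
  have h2 := sum_norm_sub_mean_sq _ _ c h1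
  have h3 : ∑ y ∈ atom a (n + 1) x, ‖diff a N f n y‖ₑ ^ 2 =
      ∑ y ∈ atom a (n + 1) x, ‖expect a n f y - c‖ₑ ^ 2 := by
    refine Finset.sum_congr rfl fun y hy => ?_
    simp only [diff_of_lt h, isAtomic_expect (n + 1) f x y hy, hc]
  have h4 : ‖c‖ₑ ^ 2 = (vol a (n + 1) * ‖c‖ₑ ^ 2) / vol a (n + 1) := by
    rw [mul_comm, ENNReal.mul_div_cancel_right (vol_ne_zero _ _) (vol_ne_top _ _)]
  rw [h4, eexp, eexp, ← ENNReal.add_div, h3]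
  congr 1
  rw [sum_enorm_sq_eq_ofReal, sum_enorm_sq_eq_ofReal, ← h2, card_atom,
    ENNReal.ofReal_add (by positivity) (by positivity), ENNReal.ofReal_mul (by positivity),
    enorm_sq_eq_ofReal, ENNReal.ofReal_natCast]

/-- Conditional Bessel inequality, by iterating Pythagoras through the scales. -/
theorem eexp_sum_enorm_diff_sq_le (h0 : ∀ i, a 0 i = 0) (ha : Monotone a) {N : ℕ}
    (f : (Fin d → ℤ) → ℂ) (j : ℕ) (hj : j ≤ N) (x : Fin d → ℤ) :
    eexp a j (fun y => ∑ n ∈ Finset.range j, ‖diff a N f n y‖ₑ ^ 2) x +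
      ‖expect a j f x‖ₑ ^ 2 ≤ eexp a j (fun y => ‖f y‖ₑ ^ 2) x := by
  induction j generalizing x with
  | zero =>
    rw [expect_of_isAtomic (isAtomic_zero h0 _), eexp_of_isAtomic (isAtomic_zero h0 _),
      eexp_of_isAtomic (isAtomic_zero h0 _)]
    simp
  | succ j ih =>
    have ih' := ih (by omega)
    simp only [Finset.sum_range_succ]
    rw [eexp_add, add_assoc, eexp_enorm_diff_sq ha hj, ← eexp_eexp ha j.le_succ, ← eexp_add,
      ← eexp_eexp ha j.le_succ (fun y => ‖f y‖ₑ ^ 2)]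
    exact eexp_mono _ ih' x

/-- The square function of a martingale is controlled, with a weight, by the maximal functions. -/
theorem sum_tsum_enorm_diff_sq_mul_le (h0 : ∀ i, a 0 i = 0) (ha : Monotone a) (N : ℕ)
    (f : (Fin d → ℤ) → ℂ) (w : (Fin d → ℤ) → ℝ≥0∞) :
    ∑ n ∈ Finset.range (N + 1), ∑' x, ‖diff a N f n x‖ₑ ^ 2 * w x ≤
      5 * ∑' x, mx a N 0 (fun y => ‖f y‖ₑ) x ^ 2 * mx a N 0 w x := by
  set δ : ℕ → (Fin d → ℤ) → ℝ≥0∞ := fun j x => mx a N j w x - mx a N (j + 1) w x with hδ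
  have hδa : ∀ j, IsAtomic a j (δ j) := fun j => isAtomic_mx_sub ha N j w id
  set S := mx a N 0 fun y => ‖f y‖ₑ with hS
  have hfS : ∀ x, ‖f x‖ₑ ≤ S x := by
    intro x
    have := enorm_mart_le (a := a) (N := N) (n := 0) f x
    simpa [mart, expect_of_isAtomic (isAtomic_zero h0 f)] using this
  -- Since $|d_n|^2$ is atomic at scale $n$, $w$ may be replaced by $\mathbb E_nw$, which is at most
  -- the sum of the increments $\delta_j$, $j\ge n$, of its maximal function.
  have h1 : ∀ n ∈ Finset.range (N + 1), ∑' x, ‖diff a N f n x‖ₑ ^ 2 * w x ≤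
      ∑' x, ∑ j ∈ Finset.Ico n (N + 1), ‖diff a N f n x‖ₑ ^ 2 * δ j x := by
    intro n hn
    have hn' : n ≤ N := by simpa [Nat.lt_succ_iff] using hn
    rw [← tsum_mul_eexp ((isAtomic_diff ha N f n).comp fun z => ‖z‖ₑ ^ 2)]
    refine ENNReal.tsum_le_tsum fun x => ?_
    rw [← Finset.mul_sum]
    gcongr
    have := rpow_mx_le_sum (a := a) hn' one_pos w x
    simp only [ENNReal.rpow_one] at this
    exact (eexp_le_mx le_rfl hn' w x).trans this
  -- For fixed $j$, the terms $n<j$ are handled by the Bessel inequality, as $\delta_j$ is atomic at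
  -- scale $j$. The term $n=j$ is bounded pointwise by $4(Mf)^2$; hence $5=1+4$.
  have h2 : ∀ j ∈ Finset.range (N + 1),
      ∑' x, ∑ n ∈ Finset.range (j + 1), ‖diff a N f n x‖ₑ ^ 2 * δ j x ≤
        ∑' x, 5 * (S x ^ 2 * δ j x) := by
    intro j hj
    have hj' : j ≤ N := by simpa [Nat.lt_succ_iff] using hj
    calc _ = ∑' x, δ j x * ∑ n ∈ Finset.range j, ‖diff a N f n x‖ₑ ^ 2 +
          ∑' x, ‖diff a N f j x‖ₑ ^ 2 * δ j x := by
          rw [← ENNReal.tsum_add]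
          refine tsum_congr fun x => ?_
          rw [Finset.sum_range_succ, Finset.mul_sum]
          simp only [mul_comm (δ j x)]
      _ = ∑' x, δ j x * eexp a j (fun y => ∑ n ∈ Finset.range j, ‖diff a N f n y‖ₑ ^ 2) x +
          ∑' x, ‖diff a N f j x‖ₑ ^ 2 * δ j x := by
          rw [tsum_mul_eexp (hδa j)]
      _ ≤ ∑' x, δ j x * eexp a j (fun y => ‖f y‖ₑ ^ 2) x +
          ∑' x, ‖diff a N f j x‖ₑ ^ 2 * δ j x := by
          gcongr with x
          exact le_self_add.trans (eexp_sum_enorm_diff_sq_le h0 ha f j hj' x)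
      _ = ∑' x, δ j x * ‖f x‖ₑ ^ 2 + ∑' x, ‖diff a N f j x‖ₑ ^ 2 * δ j x := by
          rw [tsum_mul_eexp (hδa j)]
      _ ≤ ∑' x, δ j x * S x ^ 2 + ∑' x, 4 * S x ^ 2 * δ j x := by
          gcongr with x x
          · exact hfS x
          · exact enorm_diff_sq_le N j f x
      _ = _ := by
          rw [← ENNReal.tsum_add]
          refine tsum_congr fun x => ?_
          ring
  calc _ ≤ ∑ n ∈ Finset.range (N + 1),
        ∑' x, ∑ j ∈ Finset.Ico n (N + 1), ‖diff a N f n x‖ₑ ^ 2 * δ j x := Finset.sum_le_sum h1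
    _ = ∑ j ∈ Finset.range (N + 1),
        ∑' x, ∑ n ∈ Finset.range (j + 1), ‖diff a N f n x‖ₑ ^ 2 * δ j x := by
        simp only [Summable.tsum_finsetSum fun _ _ => ENNReal.summable]
        refine Finset.sum_comm' fun n j => ?_
        simp only [Finset.mem_range, Finset.mem_Ico]
        omega
    _ ≤ ∑ j ∈ Finset.range (N + 1), ∑' x, 5 * (S x ^ 2 * δ j x) := Finset.sum_le_sum h2
    _ = 5 * ∑' x, S x ^ 2 * ∑ j ∈ Finset.range (N + 1), δ j x := by
        rw [← Summable.tsum_finsetSum fun _ _ => ENNReal.summable, ← ENNReal.tsum_mul_left]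
        simp only [Finset.mul_sum]
    _ ≤ _ := by
        gcongr with x
        exact sum_tsub_le (antitone_mx N w x) (N + 1)

/-! ### Boundary counts and cancellation -/

/-- A box that meets a set and its complement contains a boundary point of the set. -/
theorem exists_boundary_mem_Icc (S : Set (Fin d → ℤ)) {l u z w : Fin d → ℤ}
    (hz : z ∈ Set.Icc l u) (hw : w ∈ Set.Icc l u) (hzS : z ∈ S) (hwS : w ∉ S) :
    ∃ b ∈ Set.Icc l u, b ∈ S ∧ ∃ i, b + Pi.single i 1 ∉ S ∨ b - Pi.single i 1 ∉ S := by
  induction hm : ∑ i, (z i - w i).natAbs using Nat.strong_induction_on generalizing z with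
  | _ m ih =>
    subst hm
    obtain ⟨i, hi⟩ : ∃ i, z i ≠ w i := by
      by_contra! h
      exact hwS (funext h ▸ hzS)
    -- Walk from $z$ to $w$ by unit steps inside the box: either the walk leaves $S$ at the next
    -- step, or the $\ell^1$ distance drops.
    have step : ∀ e : ℤ, (z i + e - w i).natAbs < (z i - w i).natAbs →
        l i ≤ z i + e → z i + e ≤ u i → z + Pi.single i e ∈ S →
        ∃ b ∈ Set.Icc l u, b ∈ S ∧ ∃ i, b + Pi.single i 1 ∉ S ∨ b - Pi.single i 1 ∉ S := by
      intro e he hl hu hS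
      refine ih _ ?_ (z := z + Pi.single i e) ⟨fun j => ?_, fun j => ?_⟩ hS rfl
      · refine Finset.sum_lt_sum (fun j _ => ?_) ⟨i, Finset.mem_univ i, by simpa using he⟩
        rcases eq_or_ne j i with rfl | hj
        · simpa using he.le
        · simp [hj]
      · rcases eq_or_ne j i with rfl | hj
        · simpa using hl
        · simpa [hj] using hz.1 j
      · rcases eq_or_ne j i with rfl | hj
        · simpa using hu
        · simpa [hj] using hz.2 j
    have h1 : l i ≤ z i := hz.1 i
    have h2 : z i ≤ u i := hz.2 i
    have h3 : l i ≤ w i := hw.1 i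
    have h4 : w i ≤ u i := hw.2 i
    rcases lt_or_gt_of_ne hi with hlt | hlt
    · by_cases hS : z + Pi.single i 1 ∈ S
      · exact step 1 (by omega) (by omega) (by omega) hS
      · exact ⟨z, hz, hzS, i, Or.inl hS⟩
    · by_cases hS : z - Pi.single i 1 ∈ S
      · rw [sub_eq_add_neg, ← Pi.single_neg] at hS
        exact step (-1) (by omega) (by omega) (by omega) hS
      · exact ⟨z, hz, hzS, i, Or.inr hS⟩

/-- The number of points whose atom meets both a reflected set and its complement. -/
theorem card_le_B (E : Finset (Fin d → ℤ)) (n : ℕ) (x : Fin d → ℤ) (Z : Finset (Fin d → ℤ))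
    (hZ : ∀ z ∈ Z, ∃ y ∈ atom a n z, ∃ w ∈ atom a n z, x - y ∈ E ∧ x - w ∉ E) :
    Z.card ≤ B E (rect a n) := by
  rw [B, ← Set.ncard_coe_finset]
  refine Set.ncard_le_ncard_of_injOn (fun z => z - x) ?_ (fun _ _ _ _ h => sub_left_injective h)
    (finite_boundaryLayer _ _)
  intro z hz
  obtain ⟨y, hy, w, hw, hyE, hwE⟩ := hZ z hz
  have hbox : ∀ v, v ∈ atom a n z ↔ v ∈ Set.Icc (fun i => 2 ^ a n i * (z i / 2 ^ a n i))
      (fun i => 2 ^ a n i * (z i / 2 ^ a n i + 1) - 1) := by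
    intro v
    simp only [atom, Fintype.mem_piFinset, Finset.mem_Ico, Set.mem_Icc, Pi.le_def,
      Int.le_sub_one_iff, forall_and]
  obtain ⟨b, hb, hbE, i, hi⟩ := exists_boundary_mem_Icc {v | x - v ∈ E} ((hbox y).1 hy)
    ((hbox w).1 hw) hyE hwE
  -- The points $z$ and $b$ share an atom, so $z-b\in H_n$; and $(z-b)-(z-x)=x-b$ is a boundary
  -- point of $E$.
  refine ⟨z - b, ?_, ?_, i, ?_⟩
  · simp only [rect, Fintype.mem_piFinset, Finset.mem_Ico, Pi.sub_apply]
    intro j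
    have hp : (0 : ℤ) < 2 ^ a n j := by positivity
    have h1 := Int.mul_ediv_add_emod (z j) (2 ^ a n j)
    have h2 := Int.emod_nonneg (z j) hp.ne'
    have h3 := Int.emod_lt_of_pos (z j) hp
    have h4 := hb.1 j
    have h5 := hb.2 j
    simp only at h4 h5
    constructor <;> linarith
  · simpa using hbE
  · simp only [Set.mem_ofPred_eq] at hi
    have e1 : z - b - (z - x) + Pi.single i 1 = x - (b - Pi.single i 1) := by abel
    have e2 : z - b - (z - x) - Pi.single i 1 = x - (b + Pi.single i 1) := by abel
    rw [e1, e2]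
    exact hi.symm

-- Atoms contained in $F$ contribute zero, so only points whose atom sticks out of $F$ remain.
open Classical in
theorem sum_eq_sum_filter_atom {n : ℕ} {g : (Fin d → ℤ) → ℂ}
    (hg : ∀ z, ∑ y ∈ atom a n z, g y = 0) (F : Finset (Fin d → ℤ)) :
    ∑ z ∈ F, g z = ∑ z ∈ F with ¬ atom a n z ⊆ F, g z := by
  rw [← Finset.sum_filter_add_sum_filter_not F fun z => atom a n z ⊆ F, add_eq_right]
  have h : ∑ z ∈ F with atom a n z ⊆ F, ∑ y ∈ atom a n z, g y =
      vol a n • ∑ z ∈ F with atom a n z ⊆ F, g z := by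
    rw [Finset.sum_comm' (t' := {z ∈ F | atom a n z ⊆ F}) (s' := fun z => atom a n z)]
    · simp [card_atom, Finset.smul_sum]
    · have : ∀ y z, z ∈ ({z ∈ F | atom a n z ⊆ F} : Finset _) → y ∈ atom a n z →
          y ∈ ({z ∈ F | atom a n z ⊆ F} : Finset _) := by
        intro y z hz hy
        rw [Finset.mem_filter] at hz ⊢
        exact ⟨hz.2 hy, by rw [atom_eq hy]; exact hz.2⟩
      exact fun z y => ⟨fun h => ⟨mem_atom_comm.1 h.2, this _ _ h.1 h.2⟩,
        fun h => ⟨this _ _ h.2 h.1, mem_atom_comm.1 h.1⟩⟩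
  simp only [hg, Finset.sum_const_zero] at h
  exact (smul_eq_zero.1 h.symm).resolve_left (vol_pos a n).ne'

theorem norm_sum_sq_le {α : Type*} (S : Finset α) (g : α → ℂ) :
    ‖∑ z ∈ S, g z‖ ^ 2 ≤ S.card * ∑ z ∈ S, ‖g z‖ ^ 2 :=
  (pow_le_pow_left₀ (norm_nonneg _) (norm_sum_le _ _) 2).trans sq_sum_le_card_mul_sum_sq

theorem norm_sum_sq_le_of_card_le {n : ℕ} {g : (Fin d → ℤ) → ℂ}
    (hg : ∀ z, ∑ y ∈ atom a n z, g y = 0) (F : Finset (Fin d → ℤ)) (M : ℝ)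
    (hM : ∀ Z ⊆ F, (∀ z ∈ Z, ¬ atom a n z ⊆ F) → (Z.card : ℝ) ≤ M) :
    ‖∑ z ∈ F, g z‖ ^ 2 ≤ M * ∑ z ∈ F, ‖g z‖ ^ 2 := by
  classical
  rw [sum_eq_sum_filter_atom hg]
  refine (norm_sum_sq_le _ _).trans ?_
  have h1 := hM _ (Finset.filter_subset (fun z => ¬ atom a n z ⊆ F) F)
    fun z hz => (Finset.mem_filter.1 hz).2
  refine mul_le_mul h1 (Finset.sum_le_sum_of_subset_of_nonneg (Finset.filter_subset _ _)
    fun _ _ _ => by positivity) (Finset.sum_nonneg fun _ _ => by positivity)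
    ((Nat.cast_nonneg _).trans h1)

/-- The reflected set `x - E`. -/
def refl (x : Fin d → ℤ) (E : Finset (Fin d → ℤ)) : Finset (Fin d → ℤ) :=
  E.map ⟨fun y => x - y, sub_right_injective⟩

theorem mem_refl {x z : Fin d → ℤ} {E : Finset (Fin d → ℤ)} : z ∈ refl x E ↔ x - z ∈ E := by
  simp only [refl, Finset.mem_map, Function.Embedding.coeFn_mk]
  exact ⟨by rintro ⟨y, hy, rfl⟩; simpa using hy, fun h => ⟨_, h, by simp⟩⟩

theorem avg_eq (E : Finset (Fin d → ℤ)) (g : (Fin d → ℤ) → ℂ) (x : Fin d → ℤ) :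
    avg E g x = (∑ z ∈ refl x E, g z) / E.card := by
  simp [avg, refl]

theorem norm_sum_refl_sq_le {n : ℕ} {g : (Fin d → ℤ) → ℂ}
    (hg : ∀ z, ∑ y ∈ atom a n z, g y = 0) (E : Finset (Fin d → ℤ)) (x : Fin d → ℤ) {M : ℝ}
    (hM : (B E (rect a n) : ℝ) ≤ M) :
    ‖∑ z ∈ refl x E, g z‖ ^ 2 ≤ M * ∑ z ∈ refl x E, ‖g z‖ ^ 2 := by
  refine norm_sum_sq_le_of_card_le hg _ _ fun Z hZ hZ' => le_trans ?_ hM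
  refine Nat.cast_le.2 (card_le_B E n x Z fun z hz => ?_)
  obtain ⟨w, hw, hwE⟩ := Finset.not_subset.1 (hZ' z hz)
  exact ⟨z, mem_atom a n z, w, hw, mem_refl.1 (hZ hz), fun h => hwE (mem_refl.2 h)⟩

/-- An atom that meets the difference without lying in it crosses the boundary of $x-E$ or of
$x-E'$; hence the factor $2$. -/
theorem norm_sum_refl_sdiff_sq_le {n : ℕ} {g : (Fin d → ℤ) → ℂ}
    (hg : ∀ z, ∑ y ∈ atom a n z, g y = 0) (E E' : Finset (Fin d → ℤ)) (x : Fin d → ℤ) {M : ℝ}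
    (hM : (B E (rect a n) : ℝ) ≤ M) (hM' : (B E' (rect a n) : ℝ) ≤ M) :
    ‖∑ z ∈ refl x E' \ refl x E, g z‖ ^ 2 ≤
      2 * M * ∑ z ∈ refl x E' \ refl x E, ‖g z‖ ^ 2 := by
  classical
  refine norm_sum_sq_le_of_card_le hg _ _ fun Z hZ hZ' => ?_
  rw [← Finset.card_filter_add_card_filter_not fun z => ∃ w ∈ atom a n z, w ∈ refl x E,
    Nat.cast_add, two_mul]
  refine add_le_add (le_trans ?_ hM) (le_trans ?_ hM')
  · refine Nat.cast_le.2 (card_le_B E n x _ fun z hz => ?_)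
    obtain ⟨hz, w, hw, hwE⟩ := Finset.mem_filter.1 hz
    refine ⟨w, hw, z, mem_atom a n z, mem_refl.1 hwE, fun h => ?_⟩
    exact (Finset.mem_sdiff.1 (hZ hz)).2 (mem_refl.2 h)
  · refine Nat.cast_le.2 (card_le_B E' n x _ fun z hz => ?_)
    obtain ⟨hz, hz2⟩ := Finset.mem_filter.1 hz
    obtain ⟨w, hw, hwE⟩ := Finset.not_subset.1 (hZ' z hz)
    refine ⟨z, mem_atom a n z, w, hw, mem_refl.1 (Finset.mem_sdiff.1 (hZ hz)).1, fun h => ?_⟩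
    exact hwE (Finset.mem_sdiff.2 ⟨mem_refl.2 h, fun h' => hz2 ⟨w, hw, h'⟩⟩)

theorem norm_sub_sq_le (z w : ℂ) : ‖z - w‖ ^ 2 ≤ 2 * ‖z‖ ^ 2 + 2 * ‖w‖ ^ 2 := by
  have := norm_sub_le z w
  nlinarith [norm_nonneg (z - w), sq_nonneg (‖z‖ - ‖w‖)]

/-! ### Local estimates for one martingale difference -/

/-- The square variation of averages over an increasing sequence of sets. -/
theorem sum_norm_avg_sub_sq_le {α : Type*} [DecidableEq α] (m : ℕ) (e : ℕ → Finset α) (H : Finset α)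
    (g : α → ℂ) {q M : ℝ} (hq : 0 < q) (hM : 0 ≤ M) (he : ∀ i < m, e i ⊆ e (i + 1))
    (hH : ∀ i ≤ m, e i ⊆ H) (hcard : ∀ i ≤ m, q ≤ (e i).card)
    (h1 : ∀ i ≤ m, ‖∑ z ∈ e i, g z‖ ^ 2 ≤ M * ∑ z ∈ e i, ‖g z‖ ^ 2)
    (h2 : ∀ i < m, ‖∑ z ∈ e (i + 1) \ e i, g z‖ ^ 2 ≤
      2 * M * ∑ z ∈ e (i + 1) \ e i, ‖g z‖ ^ 2) :
    ∑ i ∈ Finset.range m, ‖(∑ z ∈ e i, g z) / ((e i).card : ℂ) -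
      (∑ z ∈ e (i + 1), g z) / ((e (i + 1)).card : ℂ)‖ ^ 2 ≤
      6 * M / q ^ 2 * ∑ z ∈ H, ‖g z‖ ^ 2 := by
  set T := ∑ z ∈ H, ‖g z‖ ^ 2 with hT
  have hT0 : 0 ≤ T := Finset.sum_nonneg fun _ _ => by positivity
  set r : ℕ → ℝ := fun i => ((e i).card : ℝ)⁻¹ with hr
  set v : ℕ → ℝ := fun i => ∑ z ∈ e i, ‖g z‖ ^ 2 with hv
  have hvT : ∀ i ≤ m, v i ≤ T := fun i hi =>
    Finset.sum_le_sum_of_subset_of_nonneg (hH i hi) fun _ _ _ => by positivity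
  have hv0 : ∀ i, 0 ≤ v i := fun i => Finset.sum_nonneg fun _ _ => by positivity
  have hpos : ∀ i ≤ m, (0 : ℝ) < (e i).card := fun i hi => hq.trans_le (hcard i hi)
  have hr0 : ∀ i, 0 ≤ r i := fun i => by positivity
  have hrq : ∀ i ≤ m, r i ≤ q⁻¹ := fun i hi => inv_anti₀ hq (hcard i hi)
  have hterm : ∀ i ∈ Finset.range m, ‖(∑ z ∈ e i, g z) / ((e i).card : ℂ) -
      (∑ z ∈ e (i + 1), g z) / ((e (i + 1)).card : ℂ)‖ ^ 2 ≤
      2 * (q⁻¹ * (M * T)) * (r i - r (i + 1)) + 4 * M * q⁻¹ ^ 2 * (v (i + 1) - v i) := by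
    intro i hi
    rw [Finset.mem_range] at hi
    have hdiff : r (i + 1) ≤ r i :=
      inv_anti₀ (hpos i hi.le) (Nat.cast_le.2 (Finset.card_le_card (he i hi)))
    have hsum := Finset.sum_sdiff (f := g) (he i hi)
    have hsumv := Finset.sum_sdiff (f := fun z => ‖g z‖ ^ 2) (he i hi)
    -- The change of normalization is separated from the newly added points. Both resulting bounds
    -- telescope: $r$ decreases from at most $q^{-1}$, and $v$ increases to at most $T$.
    have heq : (∑ z ∈ e i, g z) / ((e i).card : ℂ) -
        (∑ z ∈ e (i + 1), g z) / ((e (i + 1)).card : ℂ) =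
        ((r i - r (i + 1) : ℝ) : ℂ) * ∑ z ∈ e i, g z -
          (r (i + 1) : ℂ) * ∑ z ∈ e (i + 1) \ e i, g z := by
      rw [← hsum]
      simp only [hr]
      push_cast
      ring
    rw [heq]
    refine (norm_sub_sq_le _ _).trans ?_
    rw [norm_mul, norm_mul, Complex.norm_real, Complex.norm_real, Real.norm_eq_abs,
      Real.norm_eq_abs, mul_pow, mul_pow, sq_abs, sq_abs]
    have ha1 : (r i - r (i + 1)) ^ 2 * ‖∑ z ∈ e i, g z‖ ^ 2 ≤
        (q⁻¹ * (r i - r (i + 1))) * (M * T) := by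
      refine mul_le_mul ?_ ((h1 i hi.le).trans (mul_le_mul_of_nonneg_left (hvT i hi.le) hM))
        (by positivity) (mul_nonneg (by positivity) (by linarith))
      rw [sq]
      exact mul_le_mul_of_nonneg_right (by linarith [hr0 (i + 1), hrq i hi.le]) (by linarith)
    have ha2 : r (i + 1) ^ 2 * ‖∑ z ∈ e (i + 1) \ e i, g z‖ ^ 2 ≤
        q⁻¹ ^ 2 * (2 * M * (v (i + 1) - v i)) := by
      refine mul_le_mul (pow_le_pow_left₀ (hr0 _) (hrq _ hi) 2) ?_ (by positivity) (by positivity)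
      refine (h2 i hi).trans_eq ?_
      rw [eq_sub_of_add_eq hsumv]
    linarith
  refine (Finset.sum_le_sum hterm).trans ?_
  rw [Finset.sum_add_distrib, ← Finset.mul_sum, ← Finset.mul_sum, Finset.sum_range_sub',
    Finset.sum_range_sub]
  have hb1 : 2 * (q⁻¹ * (M * T)) * (r 0 - r m) ≤ 2 * (q⁻¹ * (M * T)) * q⁻¹ :=
    mul_le_mul_of_nonneg_left (by linarith [hr0 m, hrq 0 (Nat.zero_le m)]) (by positivity)
  have hb2 : 4 * M * q⁻¹ ^ 2 * (v m - v 0) ≤ 4 * M * q⁻¹ ^ 2 * T :=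
    mul_le_mul_of_nonneg_left (by linarith [hv0 0, hvT m le_rfl]) (by positivity)
  refine (add_le_add hb1 hb2).trans_eq ?_
  field_simp
  ring

theorem nbrAvg_enorm_sq (k : ℕ) (g : (Fin d → ℤ) → ℂ) (x : Fin d → ℤ) :
    nbrAvg a k (fun y => ‖g y‖ₑ ^ 2) x =
      ENNReal.ofReal ((∑ y ∈ nbr a k x, ‖g y‖ ^ 2) / vol a k) := by
  rw [nbrAvg, sum_enorm_sq_eq_ofReal, ENNReal.ofReal_div_of_pos (by exact_mod_cast vol_pos a k),
    ENNReal.ofReal_natCast]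

theorem refl_subset_nbr {k : ℕ} {E : Finset (Fin d → ℤ)} (hE : E ⊆ rect a k) (x : Fin d → ℤ) :
    refl x E ⊆ nbr a k x := by
  intro z hz
  have := sub_mem_nbr (hE (mem_refl.1 hz)) x
  rwa [sub_sub_cancel] at this

theorem card_refl (x : Fin d → ℤ) (E : Finset (Fin d → ℤ)) : (refl x E).card = E.card :=
  Finset.card_map _

theorem refl_mono (x : Fin d → ℤ) {E E' : Finset (Fin d → ℤ)} (h : E ⊆ E') :
    refl x E ⊆ refl x E' :=
  Finset.map_subset_map.2 h

/-- The constant of the local estimates. -/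
noncomputable def localConst (c : ℝ) : ℝ := 6 / c ^ 2 + 2

theorem localConst_nonneg (c : ℝ) : 0 ≤ localConst c := by
  unfold localConst
  positivity

theorem vol_le_card_rect (a : ℕ → Fin d → ℕ) (k : ℕ) : (vol a k : ℝ) ≤ (rect a k).card := by
  rw [card_rect]
  exact_mod_cast Nat.le_mul_of_pos_left _ (by positivity)

/-- The variation estimate at scale `k` in terms of the neighbourhood average. -/
theorem sum_norm_avg_sub_sq_le_nbr (k m : ℕ) (e : ℕ → Finset (Fin d → ℤ)) (x : Fin d → ℤ)
    (g : (Fin d → ℤ) → ℂ) {c κ : ℝ} (hc : 0 < c) (hκ : 0 ≤ κ) (he : ∀ i < m, e i ⊆ e (i + 1))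
    (hH : ∀ i ≤ m, e i ⊆ rect a k)
    (hcard : ∀ i ≤ m, c * ((rect a k).card : ℝ) ≤ (e i).card)
    (h1 : ∀ i ≤ m, ‖∑ z ∈ refl x (e i), g z‖ ^ 2 ≤
      κ * (rect a k).card * ∑ z ∈ refl x (e i), ‖g z‖ ^ 2)
    (h2 : ∀ i < m, ‖∑ z ∈ refl x (e (i + 1)) \ refl x (e i), g z‖ ^ 2 ≤
      2 * (κ * (rect a k).card) * ∑ z ∈ refl x (e (i + 1)) \ refl x (e i), ‖g z‖ ^ 2) :
    ∑ i ∈ Finset.range m, ‖avg (e i) g x - avg (e (i + 1)) g x‖ ^ 2 ≤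
      localConst c * κ * ((∑ y ∈ nbr a k x, ‖g y‖ ^ 2) / vol a k) := by
  have hv : (0 : ℝ) < vol a k := by exact_mod_cast vol_pos a k
  have hL := hv.trans_le (vol_le_card_rect a k)
  have h := sum_norm_avg_sub_sq_le m (fun i => refl x (e i)) (nbr a k x) g (mul_pos hc hL)
    (mul_nonneg hκ hL.le) (fun i hi => refl_mono x (he i hi))
    (fun i hi => refl_subset_nbr (hH i hi) x) (fun i hi => by simpa [card_refl] using hcard i hi)
    h1 h2
  simp only [card_refl, ← avg_eq] at h
  refine h.trans ?_
  have hT : 0 ≤ ∑ y ∈ nbr a k x, ‖g y‖ ^ 2 := Finset.sum_nonneg fun _ _ => by positivity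
  calc _ = 6 / c ^ 2 * κ * ((∑ y ∈ nbr a k x, ‖g y‖ ^ 2) / (rect a k).card) := by
        field_simp
    _ ≤ _ := by
        have hC := localConst_nonneg c
        have hC' : 6 / c ^ 2 ≤ localConst c := by rw [localConst]; linarith
        have hV := vol_le_card_rect a k
        gcongr

/-- The averages at scale `k` in terms of the neighbourhood average. -/
theorem norm_avg_sq_le_nbr (k : ℕ) (E : Finset (Fin d → ℤ)) (x : Fin d → ℤ)
    (g : (Fin d → ℤ) → ℂ) {c κ : ℝ} (hc : 0 < c) (hκ : 0 ≤ κ) (hH : E ⊆ rect a k)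
    (hcard : c * ((rect a k).card : ℝ) ≤ E.card)
    (h1 : ‖∑ z ∈ refl x E, g z‖ ^ 2 ≤ κ * (rect a k).card * ∑ z ∈ refl x E, ‖g z‖ ^ 2) :
    ‖avg E g x‖ ^ 2 ≤ 1 / c ^ 2 * κ * ((∑ y ∈ nbr a k x, ‖g y‖ ^ 2) / vol a k) := by
  have hv : (0 : ℝ) < vol a k := by exact_mod_cast vol_pos a k
  have hL := hv.trans_le (vol_le_card_rect a k)
  have hT : 0 ≤ ∑ y ∈ nbr a k x, ‖g y‖ ^ 2 := Finset.sum_nonneg fun _ _ => by positivity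
  have h2 : ∑ z ∈ refl x E, ‖g z‖ ^ 2 ≤ ∑ y ∈ nbr a k x, ‖g y‖ ^ 2 :=
    Finset.sum_le_sum_of_subset_of_nonneg (refl_subset_nbr hH x) fun _ _ _ => by positivity
  rw [avg_eq, norm_div, div_pow, Complex.norm_natCast]
  calc _ ≤ (κ * (rect a k).card * ∑ y ∈ nbr a k x, ‖g y‖ ^ 2) / (c * (rect a k).card) ^ 2 := by
        gcongr
        exact h1.trans (by gcongr)
    _ = 1 / c ^ 2 * κ * ((∑ y ∈ nbr a k x, ‖g y‖ ^ 2) / (rect a k).card) := by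
        field_simp
    _ ≤ _ := by
        gcongr
        exact_mod_cast vol_le_card_rect a k

theorem norm_expect_sq_le_nbr (k : ℕ) (x : Fin d → ℤ) (g : (Fin d → ℤ) → ℂ) :
    ‖expect a k g x‖ ^ 2 ≤ (∑ y ∈ nbr a k x, ‖g y‖ ^ 2) / vol a k := by
  have hv : (0 : ℝ) < vol a k := by exact_mod_cast vol_pos a k
  rw [expect, norm_div, div_pow, card_atom, Complex.norm_natCast]
  have h1 := norm_sum_sq_le (atom a k x) g
  rw [card_atom] at h1
  have h2 : ∑ z ∈ atom a k x, ‖g z‖ ^ 2 ≤ ∑ y ∈ nbr a k x, ‖g y‖ ^ 2 :=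
    Finset.sum_le_sum_of_subset_of_nonneg (atom_subset_nbr (mem_nbr_self k x))
      fun _ _ _ => by positivity
  rw [div_le_div_iff₀ (by positivity) hv]
  calc _ ≤ (vol a k * ∑ y ∈ nbr a k x, ‖g y‖ ^ 2) * (vol a k : ℝ) := by
        gcongr
        exact h1.trans (by gcongr)
    _ = _ := by ring

theorem norm_sum_sq_le_card_rect {k : ℕ} {F : Finset (Fin d → ℤ)}
    (hF : F.card ≤ (rect a k).card) (g : (Fin d → ℤ) → ℂ) :
    ‖∑ z ∈ F, g z‖ ^ 2 ≤ 1 * (rect a k).card * ∑ z ∈ F, ‖g z‖ ^ 2 := by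
  refine (norm_sum_sq_le F g).trans ?_
  rw [one_mul]
  gcongr

/-- All of $x-E$ lies in one atom, on which $g$ is constant. -/
theorem avg_of_nbr_subset {k j : ℕ} {E : Finset (Fin d → ℤ)} (hE : E ⊆ rect a k)
    (hE0 : E.Nonempty) {x : Fin d → ℤ} (hx : nbr a k x ⊆ atom a j x) {g : (Fin d → ℤ) → ℂ}
    (hg : IsAtomic a j g) : avg E g x = g x := by
  have hc : (E.card : ℂ) ≠ 0 := by exact_mod_cast hE0.card_pos.ne'
  rw [avg_eq, Finset.sum_congr rfl fun z hz => hg x z (hx (refl_subset_nbr hE x hz)),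
    Finset.sum_const, card_refl, nsmul_eq_mul, mul_div_cancel_left₀ _ hc]

open Classical in
/-- The indicator of the points whose neighbourhood of scale `k` is not contained in an atom of
`σ_j`. -/
noncomputable def bad (a : ℕ → Fin d → ℕ) (k j : ℕ) (x : Fin d → ℤ) : ℝ≥0∞ :=
  if nbr a k x ⊆ atom a j x then 0 else 1

/-- The local bound for the contribution of the martingale difference of scale `n` to the
oscillation at scale `k`. -/
noncomputable def localBound (a : ℕ → Fin d → ℕ) (ι : ℕ → ℝ≥0) (N : ℕ) (f : (Fin d → ℤ) → ℂ)
    (k n : ℕ) (x : Fin d → ℤ) : ℝ≥0∞ :=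
  (if n < k then (ι (k - n - 1) : ℝ≥0∞) ^ 2 else bad a k n x) *
    nbrAvg a k (fun y => ‖diff a N f n y‖ₑ ^ 2) x

variable {𝒜 : ℕ → Set (Finset (Fin d → ℤ))} {c : ℝ} {ι ε : ℕ → ℝ≥0}

theorem Criteria.nonempty (h : Criteria a 𝒜 c ι ε) {k : ℕ} {E : Finset (Fin d → ℤ)}
    (hE : E ∈ 𝒜 k) : E.Nonempty := by
  have hv : (0 : ℝ) < vol a k := by exact_mod_cast vol_pos a k
  have := (mul_pos h.c_pos (hv.trans_le (vol_le_card_rect a k))).trans_le (h.size k E hE)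
  exact Finset.card_pos.1 (by exact_mod_cast this)

theorem Criteria.B_le (h : Criteria a 𝒜 c ι ε) {k n : ℕ} (hn : n < k) {E : Finset (Fin d → ℤ)}
    (hE : E ∈ 𝒜 k) :
    (B E (rect a (n + 1)) : ℝ) ≤ (ι (k - n - 1) : ℝ) ^ 2 * (rect a k).card := by
  have hv : (0 : ℝ) < vol a k := by exact_mod_cast vol_pos a k
  have hk : n + 1 + (k - n - 1) = k := by omega
  have := h.smoothness (n + 1) (k - n - 1) E (by rwa [hk])
  rwa [hk, div_le_iff₀ (hv.trans_le (vol_le_card_rect a k))] at this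

theorem sum_atom_diff (ha : Monotone a) {N n : ℕ} (h : n < N) (f : (Fin d → ℤ) → ℂ)
    (z : Fin d → ℤ) : ∑ y ∈ atom a (n + 1) z, diff a N f n y = 0 := by
  have h1 := expect_diff ha h n.lt_succ_self f z
  rw [expect, div_eq_zero_iff] at h1
  refine h1.resolve_right ?_
  rw [card_atom]
  exact_mod_cast (vol_pos a (n + 1)).ne'

theorem le_localBound_of_lt {N k n : ℕ} (hn : n < k) (f : (Fin d → ℤ) → ℂ) (x : Fin d → ℤ)
    {X : ℝ≥0∞} {r : ℝ} (hX : X = ENNReal.ofReal r)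
    (h : r ≤ localConst c * (ι (k - n - 1) : ℝ) ^ 2 *
      ((∑ y ∈ nbr a k x, ‖diff a N f n y‖ ^ 2) / vol a k)) :
    X ≤ ENNReal.ofReal (localConst c) * localBound a ι N f k n x := by
  rw [hX, localBound, if_pos hn, nbrAvg_enorm_sq]
  refine (ENNReal.ofReal_le_ofReal h).trans_eq ?_
  have := localConst_nonneg c
  rw [ENNReal.ofReal_mul (by positivity), ENNReal.ofReal_mul this,
    ENNReal.ofReal_pow (by positivity), ENNReal.ofReal_coe_nnreal, mul_assoc]

theorem le_localBound_of_ge {N k n : ℕ} (hn : k ≤ n) (f : (Fin d → ℤ) → ℂ) (x : Fin d → ℤ)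
    {X : ℝ≥0∞} {r : ℝ} (hX : X = ENNReal.ofReal r)
    (h0 : nbr a k x ⊆ atom a n x → r = 0)
    (h : r ≤ localConst c * 1 *
      ((∑ y ∈ nbr a k x, ‖diff a N f n y‖ ^ 2) / vol a k)) :
    X ≤ ENNReal.ofReal (localConst c) * localBound a ι N f k n x := by
  rw [hX, localBound, if_neg hn.not_gt, nbrAvg_enorm_sq, bad]
  split_ifs with hx
  · simp [h0 hx]
  · refine (ENNReal.ofReal_le_ofReal h).trans_eq ?_
    have := localConst_nonneg c
    rw [ENNReal.ofReal_mul (by positivity), mul_one, one_mul]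

theorem enorm_avg_sub_expect_sq_le (ha : Monotone a) (h : Criteria a 𝒜 c ι ε) {N k n : ℕ}
    (hk : k ≤ N) (f : (Fin d → ℤ) → ℂ) {E : Finset (Fin d → ℤ)} (hE : E ∈ 𝒜 k)
    (x : Fin d → ℤ) :
    ‖avg E (diff a N f n) x - expect a k (diff a N f n) x‖ₑ ^ 2 ≤
      ENNReal.ofReal (localConst c) * localBound a ι N f k n x := by
  have hS : 0 ≤ (∑ y ∈ nbr a k x, ‖diff a N f n y‖ ^ 2) / vol a k := by positivity
  have hc := h.c_pos
  rcases lt_or_ge n k with hn | hn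
  · refine le_localBound_of_lt hn f x (enorm_sq_eq_ofReal _) ?_
    -- Here $n<k\le N$, so $d_n$ is a true difference; the uncancelled term $d_N$ only occurs in the
    -- case $k\le n$.
    rw [expect_diff ha (hn.trans_le hk) hn, sub_zero]
    refine (norm_avg_sq_le_nbr k E x _ hc (sq_nonneg (ι (k - n - 1) : ℝ)) (h.location k E hE)
      (h.size k E hE) (norm_sum_refl_sq_le (sum_atom_diff ha (hn.trans_le hk) f) E x
        (h.B_le hn hE))).trans ?_
    gcongr
    rw [localConst]
    have : 0 ≤ 5 / c ^ 2 := by positivity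
    linarith [add_div 1 5 (c ^ 2), (by norm_num : (1 : ℝ) + 5 = 6)]
  · refine le_localBound_of_ge hn f x (enorm_sq_eq_ofReal _) (fun hx => ?_) ?_
    · rw [avg_of_nbr_subset (h.location k E hE) (h.nonempty hE) hx (isAtomic_diff ha N f n),
        expect_of_isAtomic ((isAtomic_diff ha N f n).mono ha hn)]
      simp
    · have h1 := norm_avg_sq_le_nbr k E x (diff a N f n) hc zero_le_one (h.location k E hE)
        (h.size k E hE) (norm_sum_sq_le_card_rect
          (by rw [card_refl]; exact Finset.card_le_card (h.location k E hE)) _)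
      have h2 := norm_expect_sq_le_nbr (a := a) k x (diff a N f n)
      refine (norm_sub_sq_le _ _).trans ?_
      have h3 : localConst c = 2 * (1 / c ^ 2) + 2 + 4 / c ^ 2 := by rw [localConst]; ring
      have h4 : 0 ≤ 4 / c ^ 2 := by positivity
      rw [h3]
      nlinarith [mul_nonneg h4 hS]

theorem sum_enorm_avg_sub_avg_sq_le (ha : Monotone a) (h : Criteria a 𝒜 c ι ε) {N k n m : ℕ}
    (hk : k ≤ N) (f : (Fin d → ℤ) → ℂ) {e : ℕ → Finset (Fin d → ℤ)} (he : ∀ i ≤ m, e i ∈ 𝒜 k)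
    (he' : ∀ i < m, e i ⊆ e (i + 1)) (x : Fin d → ℤ) :
    ∑ i ∈ Finset.range m, ‖avg (e i) (diff a N f n) x - avg (e (i + 1)) (diff a N f n) x‖ₑ ^ 2 ≤
      ENNReal.ofReal (localConst c) * localBound a ι N f k n x := by
  have hc := h.c_pos
  have hloc : ∀ i ≤ m, e i ⊆ rect a k := fun i hi => h.location k _ (he i hi)
  have hsize := fun i hi => h.size k _ (he i hi)
  rcases lt_or_ge n k with hn | hn
  · refine le_localBound_of_lt hn f x (sum_enorm_sq_eq_ofReal _ _) ?_
    have hcanc := sum_atom_diff ha (hn.trans_le hk) f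
    exact sum_norm_avg_sub_sq_le_nbr k m e x _ hc (sq_nonneg (ι (k - n - 1) : ℝ)) he' hloc hsize
      (fun i hi => norm_sum_refl_sq_le hcanc _ x (h.B_le hn (he i hi)))
      (fun i hi => norm_sum_refl_sdiff_sq_le hcanc _ _ x (h.B_le hn (he i hi.le))
        (h.B_le hn (he _ hi)))
  · refine le_localBound_of_ge hn f x (sum_enorm_sq_eq_ofReal _ _) (fun hx => ?_) ?_
    · have havg : ∀ i ≤ m, avg (e i) (diff a N f n) x = diff a N f n x := fun i hi =>
        avg_of_nbr_subset (hloc i hi) (h.nonempty (he i hi)) hx (isAtomic_diff ha N f n)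
      refine Finset.sum_eq_zero fun i hi => ?_
      rw [Finset.mem_range] at hi
      rw [havg i hi.le, havg (i + 1) hi]
      simp
    · have hcard : ∀ i ≤ m, (refl x (e i)).card ≤ (rect a k).card := fun i hi => by
        rw [card_refl]; exact Finset.card_le_card (hloc i hi)
      refine sum_norm_avg_sub_sq_le_nbr k m e x _ hc zero_le_one he' hloc hsize
        (fun i hi => norm_sum_sq_le_card_rect (hcard i hi) _) (fun i hi => ?_)
      refine (norm_sum_sq_le_card_rect (a := a) (k := k)
        ((Finset.card_le_card Finset.sdiff_subset).trans (hcard _ hi)) _).trans ?_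
      have : 0 ≤ 1 * ((rect a k).card : ℝ) *
        ∑ z ∈ refl x (e (i + 1)) \ refl x (e i), ‖diff a N f n z‖ ^ 2 := by positivity
      linarith

/-! ### Weights and the density of bad points -/

theorem nbrAvg_mul_le {p q : ℝ} (hpq : p.HolderConjugate q) (k : ℕ)
    (u v : (Fin d → ℤ) → ℝ≥0∞) (x : Fin d → ℤ) :
    nbrAvg a k (fun y => u y * v y) x ≤
      nbrAvg a k (fun y => u y ^ p) x ^ (1 / p) * nbrAvg a k (fun y => v y ^ q) x ^ (1 / q) := by
  have h := ENNReal.inner_le_Lp_mul_Lq (nbr a k x) u v hpq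
  simp only [nbrAvg]
  rw [ENNReal.div_rpow_of_nonneg _ _ hpq.one_div_nonneg,
    ENNReal.div_rpow_of_nonneg _ _ hpq.symm.one_div_nonneg]
  have hV : (vol a k : ℝ≥0∞) = (vol a k : ℝ≥0∞) ^ (1 / p) * (vol a k : ℝ≥0∞) ^ (1 / q) := by
    rw [← ENNReal.rpow_add _ _ (vol_ne_zero a k) (vol_ne_top a k), one_div, one_div,
      hpq.inv_add_inv_eq_one, ENNReal.rpow_one]
  rw [← ENNReal.mul_div_mul_comm, ← hV]
  · exact ENNReal.div_le_div_right h _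
  · exact Or.inr (ENNReal.rpow_ne_top_of_nonneg hpq.symm.one_div_nonneg (vol_ne_top a k))
  · exact Or.inr (ENNReal.rpow_pos (pos_iff_ne_zero.2 (vol_ne_zero a k)) (vol_ne_top a k)).ne'

/-- The maximal weight `(M h ^ r) ^ (1 / r)`. -/
noncomputable def weight (a : ℕ → Fin d → ℕ) (N : ℕ) (r : ℝ) (h : (Fin d → ℤ) → ℝ≥0∞)
    (x : Fin d → ℤ) : ℝ≥0∞ :=
  nbrMax a N (fun y => h y ^ r) x ^ (1 / r)

theorem nbrAvg_mul_le_weight {r r' : ℝ} (hr : r'.HolderConjugate r) {N k : ℕ} (hk : k ≤ N)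
    (u h : (Fin d → ℤ) → ℝ≥0∞) (x : Fin d → ℤ) :
    nbrAvg a k (fun y => u y * h y) x ≤
      nbrAvg a k (fun y => u y ^ r') x ^ (1 / r') * weight a N r h x := by
  refine (nbrAvg_mul_le hr k u h x).trans ?_
  unfold weight
  gcongr
  · exact hr.symm.one_div_nonneg
  · exact Finset.le_sup (f := fun k => nbrAvg a k (fun y => h y ^ r) x)
      (Finset.mem_range.2 (Nat.lt_succ_of_le hk))

theorem nbrAvg_le_weight {r r' : ℝ} (hr : r'.HolderConjugate r) {N k : ℕ} (hk : k ≤ N)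
    (h : (Fin d → ℤ) → ℝ≥0∞) (x : Fin d → ℤ) :
    nbrAvg a k h x ≤ (3 ^ d) ^ (1 / r') * weight a N r h x := by
  simpa [nbrAvg_const] using nbrAvg_mul_le_weight (a := a) hr hk (fun _ => 1) h x

theorem nbr_subset_atom {k n : ℕ} (h : ∀ i, a k i ≤ a n i) {x y : Fin d → ℤ}
    (hy : ∀ i, 2 ^ a n i * (x i / 2 ^ a n i) + 2 ^ a k i ≤ y i ∧
      y i < 2 ^ a n i * (x i / 2 ^ a n i + 1) - 2 ^ a k i) : nbr a k y ⊆ atom a n x := by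
  intro w
  simp only [nbr, atom, Fintype.mem_piFinset, Finset.mem_Ico]
  intro hw i
  obtain ⟨h1, h2⟩ := hw i
  obtain ⟨h3, h4⟩ := hy i
  have hp : (0 : ℤ) < 2 ^ a k i := by positivity
  have hq : (2 : ℤ) ^ a n i = 2 ^ a k i * 2 ^ (a n i - a k i) := by
    rw [← pow_add, Nat.add_sub_cancel' (h i)]
  rw [hq, mul_assoc] at h3 h4 ⊢
  set M := (2 : ℤ) ^ (a n i - a k i) * (x i / (2 ^ a k i * 2 ^ (a n i - a k i)))
  rw [mul_add, mul_one] at h4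
  rw [mul_assoc, mul_add, mul_one]
  set M' := M + (2 : ℤ) ^ (a n i - a k i)
  have h5 : M + 1 ≤ y i / 2 ^ a k i := by
    rw [Int.le_ediv_iff_mul_le hp]
    linarith
  have h6 : y i / 2 ^ a k i < M' - 1 := by
    rw [Int.ediv_lt_iff_lt_mul hp]
    linarith
  constructor
  · refine le_trans ?_ h1
    exact mul_le_mul_of_nonneg_left (by omega) hp.le
  · refine h2.trans_le ?_
    exact mul_le_mul_of_nonneg_left (by omega) hp.le

/-- Bad points lie in slabs of thickness $2^{a_i(k)}$ along the $2d$ faces of the atom, each a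
fraction at most $2^{-t}$ of it. -/
theorem card_bad_le {k n t : ℕ} (h : ∀ i, a k i + t ≤ a n i) (x : Fin d → ℤ)
    (Z : Finset (Fin d → ℤ)) (hZ : ∀ y ∈ Z, y ∈ atom a n x ∧ ¬ nbr a k y ⊆ atom a n x) :
    Z.card * 2 ^ t ≤ 2 * d * vol a n := by
  classical
  set l : Fin d → ℤ := fun i => 2 ^ a n i * (x i / 2 ^ a n i) with hl
  set u : Fin d → ℤ := fun i => 2 ^ a n i * (x i / 2 ^ a n i + 1) with hu
  set T : Fin d → Finset (Fin d → ℤ) := fun i => Fintype.piFinset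
    (Function.update (fun j => Finset.Ico (l j) (u j)) i
      (Finset.Ico (l i) (l i + 2 ^ a k i) ∪ Finset.Ico (u i - 2 ^ a k i) (u i))) with hT
  have hZT : Z ⊆ Finset.univ.biUnion T := by
    intro y hy
    obtain ⟨hy1, hy2⟩ := hZ y hy
    have hbox : ∀ j, l j ≤ y j ∧ y j < u j := by
      simpa only [atom, Fintype.mem_piFinset, Finset.mem_Ico] using hy1
    obtain ⟨i, hi⟩ : ∃ i, ¬ (l i + 2 ^ a k i ≤ y i ∧ y i < u i - 2 ^ a k i) := by
      by_contra! hcon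
      exact hy2 (nbr_subset_atom (fun i => (Nat.le_add_right _ _).trans (h i)) hcon)
    rw [Finset.mem_biUnion]
    refine ⟨i, Finset.mem_univ i, ?_⟩
    rw [hT, Fintype.mem_piFinset]
    intro j
    have hj := hbox j
    rcases eq_or_ne j i with rfl | hji
    · rw [Function.update_self, Finset.mem_union, Finset.mem_Ico, Finset.mem_Ico]
      omega
    · rw [Function.update_of_ne hji, Finset.mem_Ico]
      exact hj
  have hcard : ∀ i, (T i).card * 2 ^ t ≤ 2 * vol a n := by
    intro i
    rw [hT, Fintype.card_piFinset, vol, ← Finset.mul_prod_erase _ _ (Finset.mem_univ i),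
      ← Finset.mul_prod_erase _ _ (Finset.mem_univ i), Function.update_self, mul_right_comm,
      ← mul_assoc]
    refine Nat.mul_le_mul ?_ (Finset.prod_le_prod' fun j hj => ?_)
    · refine (Nat.mul_le_mul_right _ (Finset.card_union_le _ _)).trans ?_
      rw [Int.card_Ico, Int.card_Ico, add_sub_cancel_left, sub_sub_cancel, ← two_mul, mul_assoc]
      refine Nat.mul_le_mul_left _ ?_
      have : ((2 : ℤ) ^ a k i).toNat = 2 ^ a k i := by exact_mod_cast Int.toNat_natCast _
      rw [this, ← pow_add]
      exact Nat.pow_le_pow_right (by norm_num) (h i)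
    · rw [Function.update_of_ne (Finset.ne_of_mem_erase hj), Int.card_Ico, hl, hu]
      simp only [mul_add, mul_one, add_sub_cancel_left]
      refine le_of_eq ?_
      exact_mod_cast Int.toNat_natCast _
  calc Z.card * 2 ^ t ≤ (∑ i, (T i).card) * 2 ^ t :=
        Nat.mul_le_mul_right _ ((Finset.card_le_card hZT).trans Finset.card_biUnion_le)
    _ = ∑ i, (T i).card * 2 ^ t := Finset.sum_mul _ _ _
    _ ≤ ∑ _i : Fin d, 2 * vol a n := Finset.sum_le_sum fun i _ => hcard i
    _ = _ := by simp; ring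

theorem eexp_bad_le {k n t : ℕ} (h : ∀ i, a k i + t ≤ a n i) (x : Fin d → ℤ) :
    eexp a n (bad a k n) x ≤ 2 * d * (2 ^ t)⁻¹ := by
  classical
  have h2 : (2 : ℝ≥0∞) ^ t ≠ 0 := by positivity
  have h2' : (2 : ℝ≥0∞) ^ t ≠ ∞ := by finiteness
  have hsum : ∑ y ∈ atom a n x, bad a k n y =
      (({y ∈ atom a n x | ¬ nbr a k y ⊆ atom a n x} : Finset _).card : ℝ≥0∞) := by
    rw [Finset.card_filter]
    push_cast
    refine Finset.sum_congr rfl fun y hy => ?_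
    rw [bad, atom_eq hy]
    split_ifs <;> simp_all
  rw [eexp, hsum, ← div_eq_mul_inv,
    ENNReal.le_div_iff_mul_le (Or.inl h2) (Or.inl h2'), ENNReal.mul_comm_div,
    ← mul_div_assoc]
  refine ENNReal.div_le_of_le_mul ?_
  exact_mod_cast card_bad_le h x _ fun y hy => Finset.mem_filter.1 hy

theorem nbrAvg_bad_le {k n t : ℕ} (h : ∀ i, a k i + t ≤ a n i) (x : Fin d → ℤ) :
    nbrAvg a n (bad a k n) x ≤ 3 ^ d * (2 * d * (2 ^ t)⁻¹) := by
  rw [← nbrAvg_eexp, ← nbrAvg_const n _ x]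
  exact nbrAvg_mono n (eexp_bad_le h) x

theorem tsum_nbrAvg_mul_le_weight {r r' : ℝ} (hr : r'.HolderConjugate r) {N k : ℕ} (hk : k ≤ N)
    (g h : (Fin d → ℤ) → ℝ≥0∞) :
    ∑' x, nbrAvg a k g x * h x ≤ (3 ^ d) ^ (1 / r') * ∑' x, g x * weight a N r h x := by
  rw [tsum_nbrAvg_mul, ← ENNReal.tsum_mul_left]
  refine ENNReal.tsum_le_tsum fun x => ?_
  rw [mul_left_comm]
  gcongr
  exact nbrAvg_le_weight hr hk h x

theorem tsum_bad_mul_nbrAvg_mul_le_weight (ha : Monotone a) {r r' : ℝ}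
    (hr : r'.HolderConjugate r) {N k n t : ℕ} (hkn : k ≤ n) (hn : n ≤ N)
    (ht : ∀ i, a k i + t ≤ a n i) {g : (Fin d → ℤ) → ℝ≥0∞} (hg : IsAtomic a n g)
    (h : (Fin d → ℤ) → ℝ≥0∞) :
    ∑' x, bad a k n x * nbrAvg a k g x * h x ≤
      3 ^ d * (3 ^ d * (2 * d * (2 ^ t)⁻¹)) ^ (1 / r') * ∑' x, g x * weight a N r h x := by
  have hbad : ∀ y, bad a k n y ^ r' = bad a k n y := by
    intro y
    unfold bad
    split_ifs
    · exact ENNReal.zero_rpow_of_pos hr.pos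
    · exact ENNReal.one_rpow _
  calc ∑' x, bad a k n x * nbrAvg a k g x * h x
      = ∑' x, nbrAvg a k g x * (bad a k n x * h x) := by
        refine tsum_congr fun x => ?_
        ring
    -- The neighbourhood average is moved to the weight, then averaged at the coarser scale $n$
    -- because $g$ is atomic there. Only at scale $n$ is the density of bad points small.
    _ = ∑' x, g x * eexp a n (nbrAvg a k fun y => bad a k n y * h y) x := by
        rw [tsum_nbrAvg_mul, tsum_mul_eexp hg]
    _ ≤ ∑' x, g x * (3 ^ d * ((3 ^ d * (2 * d * (2 ^ t)⁻¹)) ^ (1 / r') * weight a N r h x)) := by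
        gcongr with x
        refine (eexp_nbrAvg_le ha hkn _ x).trans ?_
        gcongr
        refine (nbrAvg_mul_le_weight hr hn _ _ x).trans ?_
        simp only [hbad]
        gcongr
        · exact hr.one_div_nonneg
        · exact nbrAvg_bad_le ht x
    _ = _ := by
        rw [← ENNReal.tsum_mul_left]
        refine tsum_congr fun x => ?_
        ring

/-! ### Growth of the sides from eccentricity -/

/-- If $H_j$ and $H_k$ are equally long in direction $i$, then for $y\in H_j$ the translate $y+H_k$
reaches a face of $H_j$. So the eccentricity quotient is at least $1$, and $\varepsilon(L)<1$ rules
this out for $j=k+L$. -/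
theorem card_rect_le_B {k j : ℕ} {i : Fin d} (hi : a j i = a k i) :
    (rect a j).card ≤ B (rect a j) (rect a k) := by
  rw [B, ← Set.ncard_coe_finset]
  refine Set.ncard_le_ncard_of_injOn (fun y => -y) ?_ (fun _ _ _ _ h => neg_injective h)
    (finite_boundaryLayer _ _)
  intro y hy
  have hy' : ∀ l, -(2 : ℤ) ^ a j l ≤ y l ∧ y l < 2 ^ a j l := by
    simpa only [rect, Finset.mem_coe, Fintype.mem_piFinset, Finset.mem_Ico] using hy
  have hp : ∀ l, (0 : ℤ) < 2 ^ a k l := fun l => by positivity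
  have hpj : ∀ l, (0 : ℤ) < 2 ^ a j l := fun l => by positivity
  obtain ⟨t, ht, hs⟩ : ∃ t : ℤ, (-(2 : ℤ) ^ a k i ≤ t ∧ t < 2 ^ a k i) ∧
      (t + y i = -2 ^ a j i ∨ t + y i = 2 ^ a j i - 1) := by
    have h1 := hy' i
    have h2 := hp i
    rw [hi] at h1 ⊢
    rcases le_or_gt (y i) 0 with h | h
    · exact ⟨-2 ^ a k i - y i, by omega, by omega⟩
    · exact ⟨2 ^ a k i - 1 - y i, by omega, by omega⟩
  refine ⟨Pi.single i t, ?_, ?_, i, ?_⟩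
  · rw [rect, Fintype.mem_piFinset]
    intro l
    have h2 := hp l
    rcases eq_or_ne l i with rfl | hl
    · simpa using ht
    · rw [Pi.single_eq_of_ne hl, Finset.mem_Ico]
      omega
  · rw [rect, Fintype.mem_piFinset]
    intro l
    have h1 := hy' l
    have h2 := hpj l
    rw [Finset.mem_Ico]
    rcases eq_or_ne l i with rfl | hl
    · simp only [sub_neg_eq_add, Pi.add_apply, Pi.single_eq_same]
      omega
    · simpa [hl] using h1
  · simp only [rect, Fintype.mem_piFinset, Finset.mem_Ico, not_forall]
    rcases hs with hs | hs
    · refine Or.inr ⟨i, ?_⟩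
      simp only [sub_neg_eq_add, Pi.add_apply, Pi.sub_apply, Pi.single_eq_same]
      omega
    · refine Or.inl ⟨i, ?_⟩
      simp only [sub_neg_eq_add, Pi.add_apply, Pi.single_eq_same]
      omega

theorem Criteria.lt_of_eccentricity_lt_one (ha : Monotone a) {𝒜 : ℕ → Set (Finset (Fin d → ℤ))}
    {c : ℝ} {ι ε : ℕ → ℝ≥0} (h : Criteria a 𝒜 c ι ε) {L : ℕ} (hL : ε L < 1) (k : ℕ) (i : Fin d) :
    a k i < a (k + L) i := by
  by_contra hcon
  have hle := ha (Nat.le_add_right k L)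
  have h1 := card_rect_le_B (i := i) (le_antisymm (not_lt.1 hcon) (hle i))
  have h2 := h.eccentricity k L
  have hv : (0 : ℝ) < vol a (k + L) := by exact_mod_cast vol_pos a (k + L)
  rw [div_le_iff₀ (hv.trans_le (vol_le_card_rect a _))] at h2
  have h3 : (ε L : ℝ) ^ 2 < 1 := pow_lt_one₀ (ε L).2 (by exact_mod_cast hL) two_ne_zero
  have h4 : ((rect a (k + L)).card : ℝ) ≤ B (rect a (k + L)) (rect a k) := by exact_mod_cast h1
  have h5 := hv.trans_le (vol_le_card_rect a (k + L))
  nlinarith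

theorem add_div_le (ha : Monotone a) {L : ℕ} (hL : ∀ k i, a k i < a (k + L) i) (k m : ℕ)
    (i : Fin d) : a k i + m / L ≤ a (k + m) i := by
  have h : ∀ t, a k i + t ≤ a (k + L * t) i := by
    intro t
    induction t with
    | zero => simp
    | succ t ih =>
      have := hL (k + L * t) i
      rw [mul_add, mul_one, ← add_assoc k]
      omega
  exact (h _).trans (ha (Nat.add_le_add_left (Nat.mul_div_le m L) k) i)

theorem tsum_pow_div_ne_top {b : ℝ≥0} (hb : b < 1) {L : ℕ} (hL : L ≠ 0) :
    ∑' m : ℕ, ((b ^ (m / L) : ℝ≥0) : ℝ≥0∞) ≠ ∞ := by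
  have : NeZero L := ⟨hL⟩
  have h := (Nat.divModEquiv L).tsum_eq fun q : ℕ × Fin L => ((b ^ q.1 : ℝ≥0) : ℝ≥0∞)
  simp only [Nat.divModEquiv_apply] at h
  rw [h, ENNReal.tsum_prod (f := fun n (_ : Fin L) => ((b ^ n : ℝ≥0) : ℝ≥0∞))]
  simp only [tsum_fintype, Finset.sum_const, nsmul_eq_mul, ENNReal.tsum_mul_left,
    ENNReal.coe_pow, ENNReal.tsum_geometric]
  refine ENNReal.mul_ne_top (by simp) (ENNReal.inv_ne_top.2 ?_)
  exact (tsub_pos_of_lt (by exact_mod_cast hb)).ne'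

/-! ### Summation over the scales -/

/-- The kernel that measures the interaction of the scales `k` and `n`. -/
def scaleKernel {R : Type*} (u v : ℕ → R) (k n : ℕ) : R :=
  if n < k then u (k - n - 1) else v (n - k)

theorem sum_comp_le_tsum {u : ℕ → ℝ≥0∞} (S : Finset ℕ) {φ : ℕ → ℕ} (hφ : Set.InjOn φ S) :
    ∑ n ∈ S, u (φ n) ≤ ∑' l, u l := by
  classical
  rw [← Finset.sum_image hφ]
  exact ENNReal.sum_le_tsum _

theorem sum_scaleKernel_le (u v : ℕ → ℝ≥0∞) (k M : ℕ) :
    ∑ n ∈ Finset.range M, scaleKernel u v k n ≤ ∑' l, u l + ∑' l, v l := by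
  simp only [scaleKernel]
  rw [Finset.sum_ite]
  refine add_le_add (sum_comp_le_tsum _ ?_) (sum_comp_le_tsum _ ?_)
  all_goals
    intro x hx y hy hxy
    simp only [Finset.coe_filter, Finset.mem_range, Set.mem_ofPred_eq] at hx hy
    beta_reduce at hxy
    omega

theorem sum_scaleKernel_le' (u v : ℕ → ℝ≥0∞) (n M : ℕ) :
    ∑ k ∈ Finset.range M, scaleKernel u v k n ≤ ∑' l, u l + ∑' l, v l := by
  simp only [scaleKernel]
  rw [Finset.sum_ite]
  refine add_le_add (sum_comp_le_tsum _ ?_) (sum_comp_le_tsum _ ?_)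
  all_goals
    intro x hx y hy hxy
    simp only [Finset.coe_filter, Finset.mem_range, Set.mem_ofPred_eq] at hx hy
    beta_reduce at hxy
    omega

theorem coe_scaleKernel (u v : ℕ → ℝ≥0) (k n : ℕ) :
    ((scaleKernel u v k n : ℝ≥0) : ℝ≥0∞) =
      scaleKernel (R := ℝ≥0∞) (fun l => u l) (fun l => v l) k n := by
  simp only [scaleKernel]
  split_ifs <;> rfl

/-- Cauchy–Schwarz for $z=\kappa^{1/2}\cdot\kappa^{-1/2}z$. The local bounds decay like $\kappa^2$,
so one factor $\kappa$ remains to sum over $k$. -/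
theorem sum_sq_le_weighted (S : Finset ℕ) {κ : ℕ → ℝ≥0} (hκ : ∀ n, κ n ≠ 0) (z : ℕ → ℝ≥0) :
    (∑ n ∈ S, (z n : ℝ≥0∞)) ^ 2 ≤
      (∑ n ∈ S, (κ n : ℝ≥0∞)) * ∑ n ∈ S, ((κ n)⁻¹ : ℝ≥0) * (z n : ℝ≥0∞) ^ 2 := by
  have h := Finset.sum_sq_le_sum_mul_sum_of_sq_le_mul S (r := z) (f := κ)
    (g := fun n => (κ n)⁻¹ * z n ^ 2) (fun _ _ => zero_le) (fun _ _ => zero_le)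
    (fun n _ => (mul_inv_cancel_left₀ (hκ n) _).ge)
  exact_mod_cast h

theorem sum_enorm_sum_sq_le {m : ℕ} (S : Finset ℕ) {κ : ℕ → ℝ≥0} (hκ : ∀ n, κ n ≠ 0)
    (z : ℕ → ℕ → ℂ) {K : ℝ≥0∞} {Q : ℕ → ℝ≥0∞}
    (hQ : ∀ n ∈ S, ∑ i ∈ Finset.range m, ‖z i n‖ₑ ^ 2 ≤ K * Q n) :
    ∑ i ∈ Finset.range m, ‖∑ n ∈ S, z i n‖ₑ ^ 2 ≤
      K * (∑ n ∈ S, (κ n : ℝ≥0∞)) * ∑ n ∈ S, ((κ n)⁻¹ : ℝ≥0) * Q n := by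
  calc ∑ i ∈ Finset.range m, ‖∑ n ∈ S, z i n‖ₑ ^ 2
      ≤ ∑ i ∈ Finset.range m, (∑ n ∈ S, (κ n : ℝ≥0∞)) *
          ∑ n ∈ S, ((κ n)⁻¹ : ℝ≥0) * ‖z i n‖ₑ ^ 2 := by
        refine Finset.sum_le_sum fun i _ => le_trans ?_
          (sum_sq_le_weighted S hκ fun n => ‖z i n‖₊)
        gcongr
        exact enorm_sum_le _ _
    _ = (∑ n ∈ S, (κ n : ℝ≥0∞)) *
          ∑ n ∈ S, ((κ n)⁻¹ : ℝ≥0) * ∑ i ∈ Finset.range m, ‖z i n‖ₑ ^ 2 := by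
        rw [← Finset.mul_sum, Finset.sum_comm]
        simp only [Finset.mul_sum]
    _ ≤ (∑ n ∈ S, (κ n : ℝ≥0∞)) * ∑ n ∈ S, ((κ n)⁻¹ : ℝ≥0) * (K * Q n) := by
        gcongr with n hn
        exact hQ n hn
    _ = _ := by
        simp only [mul_left_comm _ K, ← Finset.mul_sum]
        ring

theorem tsum_localBound_mul_le (ha : Monotone a) {r r' : ℝ} (hr : r'.HolderConjugate r)
    {L : ℕ} (hL : ∀ k i, a k i < a (k + L) i) {ι u : ℕ → ℝ≥0} (hu : ∀ l, ι l ≤ u l)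
    {b : ℝ≥0} (hb : b ^ 2 = (2⁻¹) ^ (1 / r')) {N k n : ℕ} (hk : k ≤ N) (hn : n ≤ N)
    (f : (Fin d → ℤ) → ℂ) (h : (Fin d → ℤ) → ℝ≥0∞) :
    ∑' x, localBound a ι N f k n x * h x ≤
      ((3 ^ d) ^ (1 / r') + 3 ^ d * (3 ^ d * (2 * d)) ^ (1 / r')) *
        (((scaleKernel u (fun m => b ^ (m / L)) k n : ℝ≥0) : ℝ≥0∞) ^ 2 *
          ∑' x, ‖diff a N f n x‖ₑ ^ 2 * weight a N r h x) := by
  rcases lt_or_ge n k with hnk | hnk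
  · simp only [localBound, scaleKernel, if_pos hnk, mul_assoc, ENNReal.tsum_mul_left]
    calc _ ≤ (ι (k - n - 1) : ℝ≥0∞) ^ 2 * ((3 ^ d) ^ (1 / r') *
          ∑' x, ‖diff a N f n x‖ₑ ^ 2 * weight a N r h x) := by
          gcongr
          exact tsum_nbrAvg_mul_le_weight hr hk _ h
      _ ≤ (u (k - n - 1) : ℝ≥0∞) ^ 2 *
          (((3 ^ d) ^ (1 / r') + 3 ^ d * (3 ^ d * (2 * d)) ^ (1 / r')) *
          ∑' x, ‖diff a N f n x‖ₑ ^ 2 * weight a N r h x) := by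
          gcongr
          · exact hu _
          · exact le_self_add
      _ = _ := by ring
  · simp only [localBound, scaleKernel, if_neg hnk.not_gt]
    have ht : ∀ i, a k i + (n - k) / L ≤ a n i := fun i => by
      simpa [Nat.add_sub_cancel' hnk] using add_div_le ha hL k (n - k) i
    refine (tsum_bad_mul_nbrAvg_mul_le_weight ha hr hnk hn ht
      ((isAtomic_diff ha N f n).comp fun z => ‖z‖ₑ ^ 2) h).trans ?_
    have hb' : (((2 : ℝ≥0∞) ^ ((n - k) / L))⁻¹) ^ (1 / r') =
        ((b ^ ((n - k) / L) : ℝ≥0) : ℝ≥0∞) ^ 2 := by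
      have h1 : (b : ℝ≥0∞) ^ 2 = (2⁻¹) ^ (1 / r') := by
        rw [← ENNReal.coe_pow, hb, ENNReal.coe_rpow_of_nonneg _ hr.one_div_nonneg,
          ENNReal.coe_inv two_ne_zero, ENNReal.coe_ofNat]
      rw [ENNReal.coe_pow, ← pow_mul, mul_comm _ 2, pow_mul, h1, ENNReal.inv_pow,
        ← ENNReal.rpow_natCast, ← ENNReal.rpow_natCast, ← ENNReal.rpow_mul, ← ENNReal.rpow_mul,
        mul_comm]
    calc _ = 3 ^ d * (3 ^ d * (2 * d)) ^ (1 / r') *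
          (((b ^ ((n - k) / L) : ℝ≥0) : ℝ≥0∞) ^ 2 *
          ∑' x, ‖diff a N f n x‖ₑ ^ 2 * weight a N r h x) := by
          rw [← hb', ← mul_assoc (3 ^ d : ℝ≥0∞) (2 * d), ENNReal.mul_rpow_of_nonneg _ _
            hr.one_div_nonneg]
          ring
      _ ≤ _ := by
          gcongr
          exact le_add_self

/-- The weighted estimate that dominates both square functions. -/
theorem tsum_tsum_mul_le (h0 : ∀ i, a 0 i = 0) (ha : Monotone a) {r r' : ℝ}
    (hr : r'.HolderConjugate r) {L : ℕ} (hL : ∀ k i, a k i < a (k + L) i) {ι u : ℕ → ℝ≥0}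
    (hu : ∀ l, ι l ≤ u l) (hu0 : ∀ l, u l ≠ 0) {b : ℝ≥0} (hb0 : b ≠ 0)
    (hb : b ^ 2 = (2⁻¹) ^ (1 / r')) (f : (Fin d → ℤ) → ℂ) (V : ℕ → (Fin d → ℤ) → ℝ≥0∞) {K : ℝ≥0∞}
    (hV : ∀ N k, k ≤ N → ∀ x, ∀ κ : ℕ → ℝ≥0, (∀ n, κ n ≠ 0) →
      V k x ≤ K * (∑ n ∈ Finset.range (N + 1), (κ n : ℝ≥0∞)) *
        ∑ n ∈ Finset.range (N + 1), ((κ n)⁻¹ : ℝ≥0) * localBound a ι N f k n x)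
    (h : (Fin d → ℤ) → ℝ≥0∞) {T : ℝ≥0∞}
    (hT : ∀ N, ∑' x, mx a N 0 (fun y => ‖f y‖ₑ) x ^ 2 * mx a N 0 (weight a N r h) x ≤ T) :
    ∑' x, (∑' k, V k x) * h x ≤
      K * (∑' l, (u l : ℝ≥0∞) + ∑' m, ((b ^ (m / L) : ℝ≥0) : ℝ≥0∞)) ^ 2 *
        ((3 ^ d) ^ (1 / r') + 3 ^ d * (3 ^ d * (2 * d)) ^ (1 / r')) * 5 * T := by
  set Γ := ∑' l, (u l : ℝ≥0∞) + ∑' m, ((b ^ (m / L) : ℝ≥0) : ℝ≥0∞) with hΓ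
  set C := ((3 : ℝ≥0∞) ^ d) ^ (1 / r') + 3 ^ d * (3 ^ d * (2 * d)) ^ (1 / r') with hC
  set κ : ℕ → ℕ → ℝ≥0 := scaleKernel u fun m => b ^ (m / L) with hκ
  have hκ0 : ∀ k n, κ k n ≠ 0 := by
    intro k n
    simp only [hκ, scaleKernel]
    split_ifs
    · exact hu0 _
    · exact pow_ne_zero _ hb0
  simp only [← ENNReal.tsum_mul_right]
  rw [ENNReal.tsum_comm]
  refine ENNReal.tsum_le_of_sum_range_le fun N => ?_
  -- With the scales $k\le N$ retained, $f$ is decomposed with this same cutoff $N$; all bounds are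
  -- uniform in it.
  refine (Finset.sum_le_sum_of_subset (Finset.range_mono N.le_succ)).trans ?_
  set I : ℕ → ℝ≥0∞ := fun n => ∑' x, ‖diff a N f n x‖ₑ ^ 2 * weight a N r h x with hI
  have hterm : ∀ k ∈ Finset.range (N + 1), ∑' x, V k x * h x ≤
      K * Γ * ∑ n ∈ Finset.range (N + 1), C * (κ k n * I n) := by
    intro k hk
    have hk' : k ≤ N := by simpa [Nat.lt_succ_iff] using hk
    calc ∑' x, V k x * h x
        ≤ ∑' x, (K * Γ * ∑ n ∈ Finset.range (N + 1),
            ((κ k n)⁻¹ : ℝ≥0) * localBound a ι N f k n x) * h x := by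
          gcongr with x
          refine (hV N k hk' x (κ k) (hκ0 k)).trans ?_
          gcongr
          simp only [hκ, coe_scaleKernel]
          exact sum_scaleKernel_le _ _ k (N + 1)
      _ = K * Γ * ∑ n ∈ Finset.range (N + 1),
            ((κ k n)⁻¹ : ℝ≥0) * ∑' x, localBound a ι N f k n x * h x := by
          simp only [mul_assoc, Finset.sum_mul, ENNReal.tsum_mul_left]
          rw [Summable.tsum_finsetSum fun _ _ => ENNReal.summable]
          simp only [ENNReal.tsum_mul_left]
      _ ≤ K * Γ * ∑ n ∈ Finset.range (N + 1),
            ((κ k n)⁻¹ : ℝ≥0) * (C * ((κ k n : ℝ≥0∞) ^ 2 * I n)) := by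
          gcongr with n hn
          exact tsum_localBound_mul_le ha hr hL hu hb hk'
            (by simpa [Nat.lt_succ_iff] using hn) f h
      _ = _ := by
          congr 1
          refine Finset.sum_congr rfl fun n _ => ?_
          have : (((κ k n)⁻¹ : ℝ≥0) : ℝ≥0∞) * (κ k n : ℝ≥0∞) ^ 2 = κ k n := by
            rw [← ENNReal.coe_pow, ← ENNReal.coe_mul, sq, inv_mul_cancel_left₀ (hκ0 k n)]
          rw [mul_left_comm, ← mul_assoc _ _ (I n), this]
  calc _ ≤ ∑ k ∈ Finset.range (N + 1),
        K * Γ * ∑ n ∈ Finset.range (N + 1), C * (κ k n * I n) := Finset.sum_le_sum hterm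
    _ = K * Γ * (C * ∑ n ∈ Finset.range (N + 1),
          (∑ k ∈ Finset.range (N + 1), (κ k n : ℝ≥0∞)) * I n) := by
        rw [← Finset.mul_sum, Finset.sum_comm]
        simp only [Finset.sum_mul, Finset.mul_sum]
    _ ≤ K * Γ * (C * ∑ n ∈ Finset.range (N + 1), Γ * I n) := by
        gcongr with n
        simp only [hκ, coe_scaleKernel]
        exact sum_scaleKernel_le' _ _ n (N + 1)
    _ ≤ K * Γ * (C * (Γ * (5 * T))) := by
        rw [← Finset.mul_sum]
        gcongr
        refine (sum_tsum_enorm_diff_sq_mul_le h0 ha N f _).trans ?_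
        gcongr
        exact hT N
    _ = _ := by ring

/-! ### The $L^p$ bound by duality, and conclusion -/

theorem exists_eLpNorm_le (d : ℕ) {p : ℝ≥0∞} (hp : 2 < p) (hp' : p < ⊤) {ι : ℕ → ℝ≥0}
    (hι : Summable ι) {L : ℕ} (hL : L ≠ 0) (K : ℝ≥0) :
    ∃ C : ℝ≥0, ∀ a : ℕ → Fin d → ℕ, (∀ i, a 0 i = 0) → Monotone a →
      (∀ k i, a k i < a (k + L) i) → ∀ (f : (Fin d → ℤ) → ℂ) (V : ℕ → (Fin d → ℤ) → ℝ≥0∞),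
      (∀ N k, k ≤ N → ∀ x, ∀ κ : ℕ → ℝ≥0, (∀ n, κ n ≠ 0) →
        V k x ≤ K * (∑ n ∈ Finset.range (N + 1), (κ n : ℝ≥0∞)) *
          ∑ n ∈ Finset.range (N + 1), ((κ n)⁻¹ : ℝ≥0) * localBound a ι N f k n x) →
      MeasureTheory.eLpNorm (fun x => (∑' k, V k x) ^ (1 / 2 : ℝ)) p MeasureTheory.Measure.count
        ≤ C * MeasureTheory.eLpNorm f p MeasureTheory.Measure.count := by
  set P := p.toReal with hP
  have hP2 : 2 < P := by
    have := (ENNReal.toReal_lt_toReal (by norm_num) hp'.ne).2 hp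
    simpa using this
  have hP0 : 0 < P := by linarith
  have hq := Real.HolderConjugate.conjExponent (p := P / 2) (by linarith)
  set q := P / 2 with hqdef
  set s := q.conjExponent
  have hs1 : 1 < s := hq.symm.lt
  -- $r>1$ keeps a positive power $1/r'$ of the bad density; $r<s$ makes the weight bounded on
  -- $L^s$, through $L^{s/r}$.
  obtain ⟨r, hr1, hrs⟩ := exists_between hs1
  have hr := (Real.HolderConjugate.conjExponent hr1).symm
  set r' := r.conjExponent
  obtain ⟨C1, hC1⟩ := tsum_rpow_mx_le (s := P) (by linarith)
  obtain ⟨C2, hC2⟩ := tsum_rpow_mx_le hs1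
  obtain ⟨C3, hC3⟩ := tsum_rpow_nbrMax_le d (s := s / r) ((one_lt_div (by linarith)).2 hrs)
  -- A summable majorant of $\iota$ without zeros, as the kernel gets inverted.
  set u : ℕ → ℝ≥0 := fun l => ι l + (1 / 2) ^ l with hudef
  have hu : ∀ l, ι l ≤ u l := fun l => le_self_add
  have hu0 : ∀ l, u l ≠ 0 := fun l => (add_pos_of_nonneg_of_pos zero_le (by positivity)).ne'
  have husum : ∑' l, (u l : ℝ≥0∞) ≠ ∞ :=
    ENNReal.tsum_coe_ne_top_iff_summable.2 (hι.add (NNReal.summable_geometric (by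
      rw [← NNReal.coe_lt_coe]; norm_num)))
  set b : ℝ≥0 := (2⁻¹) ^ (1 / r' / 2) with hbdef
  have hb0 : b ≠ 0 := (NNReal.rpow_pos (by positivity)).ne'
  have hb : b ^ 2 = (2⁻¹) ^ (1 / r') := by
    rw [hbdef, ← NNReal.rpow_natCast, ← NNReal.rpow_mul]
    congr 1
    push_cast
    ring
  have hb1 : b < 1 := NNReal.rpow_lt_one (by rw [← NNReal.coe_lt_coe]; norm_num)
    (div_pos hr.one_div_pos two_pos)
  have hbsum := tsum_pow_div_ne_top hb1 hL
  set Γ := ∑' l, (u l : ℝ≥0∞) + ∑' m, ((b ^ (m / L) : ℝ≥0) : ℝ≥0∞) with hΓ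
  set C0 : ℝ≥0∞ := K * Γ ^ 2 *
    ((3 ^ d) ^ (1 / r') + 3 ^ d * (3 ^ d * (2 * d)) ^ (1 / r')) * 5 *
      ((C1 : ℝ≥0∞) ^ (1 / q) * (C2 * C3 : ℝ≥0∞) ^ (1 / s)) with hC0
  have hC0top : C0 ≠ ∞ := by
    have e1 : ((3 : ℝ≥0∞) ^ d) ^ (1 / r') ≠ ∞ :=
      ENNReal.rpow_ne_top_of_nonneg hr.one_div_nonneg (by finiteness)
    have e2 : ((3 : ℝ≥0∞) ^ d * (2 * d)) ^ (1 / r') ≠ ∞ :=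
      ENNReal.rpow_ne_top_of_nonneg hr.one_div_nonneg (by finiteness)
    have e3 : (C1 : ℝ≥0∞) ^ (1 / q) ≠ ∞ :=
      ENNReal.rpow_ne_top_of_nonneg hq.one_div_nonneg (by finiteness)
    have e4 : (C2 * C3 : ℝ≥0∞) ^ (1 / s) ≠ ∞ :=
      ENNReal.rpow_ne_top_of_nonneg hq.symm.one_div_nonneg (by finiteness)
    finiteness
  refine ⟨(C0 ^ (1 / 2 : ℝ)).toNNReal, fun a h0 ha hLa f V hV => ?_⟩
  rw [ENNReal.coe_toNNReal (ENNReal.rpow_ne_top_of_nonneg (by norm_num) hC0top)]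
  have hp0 : p ≠ 0 := (pos_of_gt hp).ne'
  rw [MeasureTheory.eLpNorm_eq_lintegral_rpow_enorm_toReal hp0 hp'.ne,
    MeasureTheory.eLpNorm_eq_lintegral_rpow_enorm_toReal hp0 hp'.ne,
    MeasureTheory.lintegral_count, MeasureTheory.lintegral_count, ← hP]
  set X := ∑' x, ‖f x‖ₑ ^ P with hX
  have hweight : ∀ N (h : (Fin d → ℤ) → ℝ≥0∞),
      ∑' x, mx a N 0 (fun y => ‖f y‖ₑ) x ^ 2 * mx a N 0 (weight a N r h) x ≤
        ((C1 : ℝ≥0∞) ^ (1 / q) * (C2 * C3 : ℝ≥0∞) ^ (1 / s)) * X ^ (1 / q) *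
          (∑' x, h x ^ s) ^ (1 / s) := by
    intro N h
    refine (tsum_mul_le_Lp_mul_Lq hq _ _).trans ?_
    have e1 : ∑' x, (mx a N 0 (fun y => ‖f y‖ₑ) x ^ 2) ^ q ≤ C1 * X := by
      refine le_trans (le_of_eq (tsum_congr fun x => ?_)) (hC1 a ha N fun y => ‖f y‖ₑ)
      rw [← ENNReal.rpow_natCast, ← ENNReal.rpow_mul]
      congr 1
      push_cast
      rw [hqdef]
      ring
    have e2 : ∑' x, mx a N 0 (weight a N r h) x ^ s ≤ C2 * C3 * ∑' x, h x ^ s := by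
      refine (hC2 a ha N _).trans ?_
      rw [mul_assoc]
      gcongr
      have e3 : ∀ x, weight a N r h x ^ s = nbrMax a N (fun y => h y ^ r) x ^ (s / r) := by
        intro x
        rw [weight, ← ENNReal.rpow_mul]
        congr 1
        ring
      simp only [e3]
      refine (hC3 a ha N _).trans_eq ?_
      simp only [← ENNReal.rpow_mul, mul_div_cancel₀ s hr.symm.pos.ne']
    calc _ ≤ (C1 * X) ^ (1 / q) * (C2 * C3 * ∑' x, h x ^ s) ^ (1 / s) := by
          gcongr
      _ = _ := by
          rw [ENNReal.mul_rpow_of_nonneg _ _ hq.one_div_nonneg,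
            ENNReal.mul_rpow_of_nonneg _ (∑' x, h x ^ s) hq.symm.one_div_nonneg]
          ring
  have hdual : (∑' x, (∑' k, V k x) ^ q) ^ (1 / q) ≤ C0 * X ^ (1 / q) := by
    refine rpow_tsum_le_of_forall_tsum_mul_le hq fun h => ?_
    refine (tsum_tsum_mul_le h0 ha hr hLa hu hu0 hb0 hb f V hV h fun N => hweight N h).trans_eq ?_
    rw [hC0]
    ring
  have e1 : ∀ x, ‖(∑' k, V k x) ^ (1 / 2 : ℝ)‖ₑ ^ P = (∑' k, V k x) ^ q := by
    intro x
    rw [enorm_eq_self, ← ENNReal.rpow_mul]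
    congr 1
    rw [hqdef]
    ring
  have e2 : 1 / P = 1 / q * (1 / 2) := by rw [hqdef]; field_simp
  simp only [e1]
  rw [e2, ENNReal.rpow_mul, ENNReal.rpow_mul, ← ENNReal.mul_rpow_of_nonneg _ _ (by norm_num)]
  exact ENNReal.rpow_le_rpow hdual (by norm_num)

theorem avg_sum (E : Finset (Fin d → ℤ)) (S : Finset ℕ) (g : ℕ → (Fin d → ℤ) → ℂ)
    (x : Fin d → ℤ) : avg E (fun y => ∑ n ∈ S, g n y) x = ∑ n ∈ S, avg E (g n) x := by
  simp only [avg]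
  rw [Finset.sum_comm, Finset.sum_div]

theorem expect_sum (k : ℕ) (S : Finset ℕ) (g : ℕ → (Fin d → ℤ) → ℂ)
    (x : Fin d → ℤ) : expect a k (fun y => ∑ n ∈ S, g n y) x = ∑ n ∈ S, expect a k (g n) x := by
  simp only [expect]
  rw [Finset.sum_comm, Finset.sum_div]

end JRW

theorem mainTheorem1 (d : ℕ) (p : ℝ≥0∞) (hp : 2 < p) (hp' : p < ⊤)
    (c : ℝ) (ι ε : ℕ → ℝ≥0) :
    ∃ C : ℝ≥0, ∀ (a : ℕ → Fin d → ℕ) (𝒜 : ℕ → Set (Finset (Fin d → ℤ)))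
      (E : ℕ → Finset (Fin d → ℤ)),
      JRW.IsDyadicScale a → JRW.Criteria a 𝒜 c ι ε → JRW.IsRegularFamily 𝒜 E →
      ∀ f : (Fin d → ℤ) → ℂ, MeasureTheory.MemLp f p MeasureTheory.Measure.count →
        MeasureTheory.eLpNorm (JRW.longSquare a E f) p MeasureTheory.Measure.count
            ≤ C * MeasureTheory.eLpNorm f p MeasureTheory.Measure.count ∧
        MeasureTheory.eLpNorm (JRW.shortSquare E f) p MeasureTheory.Measure.count
            ≤ C * MeasureTheory.eLpNorm f p MeasureTheory.Measure.count := by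
  -- Summability is part of `Criteria`, so otherwise the claim is vacuous. The case split comes
  -- before the choice of $C$, which needs $\Gamma$ finite and $L$.
  by_cases hι : Summable ι
  swap
  · exact ⟨0, fun a 𝒜 E _ hC => absurd hC.summable_smoothness hι⟩
  by_cases hε : Summable ε
  swap
  · exact ⟨0, fun a 𝒜 E _ hC => absurd hC.summable_eccentricity hε⟩
  obtain ⟨L, hL0, hL⟩ : ∃ L, L ≠ 0 ∧ ε L < 1 := by
    have h1 := (NNReal.tendsto_atTop_zero_of_summable hε).eventually_lt_const zero_lt_one
    obtain ⟨L, hL, hL'⟩ := (h1.and (Filter.eventually_ne_atTop 0)).exists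
    exact ⟨L, hL', hL⟩
  obtain ⟨C, hC⟩ := JRW.exists_eLpNorm_le d hp hp' hι hL0 (JRW.localConst c).toNNReal
  refine ⟨C, fun a 𝒜 E hscale hcrit hreg f _ => ?_⟩
  have ha : Monotone a := monotone_nat_of_le_succ hscale.mono
  have hgrow := hcrit.lt_of_eccentricity_lt_one ha hL
  refine ⟨hC a hscale.zero ha hgrow f _ ?_, hC a hscale.zero ha hgrow f _ ?_⟩
  · intro N k hk x κ hκ
    refine iSup₂_le fun t ht => ?_
    -- The long function is treated as a variation with a single term.
    have h := JRW.sum_enorm_sum_sq_le (m := 1) (Finset.range (N + 1)) hκ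
      (fun _ n => JRW.avg (E t) (JRW.diff a N f n) x - JRW.expect a k (JRW.diff a N f n) x)
      (K := (JRW.localConst c).toNNReal) (Q := fun n => JRW.localBound a ι N f k n x)
      fun n _ => by
        rw [Finset.sum_range_one]
        exact JRW.enorm_avg_sub_expect_sq_le ha hcrit hk f (hreg k t ht t ht le_rfl).2.1 x
    rw [Finset.sum_range_one, Finset.sum_sub_distrib, ← JRW.avg_sum, ← JRW.expect_sum] at h
    simpa only [JRW.sum_diff hscale.zero] using h
  · intro N k hk x κ hκ
    refine iSup_le fun m => iSup_le fun t => iSup_le fun hmono => iSup_le fun ht => ?_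
    have h := JRW.sum_enorm_sum_sq_le (m := m) (Finset.range (N + 1)) hκ
      (fun i n => JRW.avg (E (t i)) (JRW.diff a N f n) x -
        JRW.avg (E (t (i + 1))) (JRW.diff a N f n) x)
      (K := (JRW.localConst c).toNNReal) (Q := fun n => JRW.localBound a ι N f k n x)
      fun n _ => JRW.sum_enorm_avg_sub_avg_sq_le ha hcrit hk f (e := fun i => E (t i))
        (fun i hi => (hreg k (t i) (ht i hi) (t i) (ht i hi) le_rfl).2.1)
        (fun i hi => (hreg k (t i) (ht i hi.le) (t (i + 1)) (ht (i + 1) hi)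
          (hmono i.lt_succ_self).le).1) x
    simp only [Finset.sum_sub_distrib, ← JRW.avg_sum, JRW.sum_diff hscale.zero] at h
    exact h
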